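/- Let $\Psi:\mathbb R\to\mathbb R$ be an even convex function such that $d\mu_\Psi(x)=e^{-\Psi(x)}\,dx$ is a probability measure on $\mathbb R$. Let $\alpha\in(1,2]$ and $x_0>0$. Assume that on $[x_0,\infty)$ the function $\Psi$ is of class $\mathcal C^2$, that $\Psi(x)/x^2$ is non-increasing and $\Psi(x)/x^\alpha$ is non-decreasing there, and that $$\limsup_{x\to+\infty}\frac{\Psi''(x)}{\Psi'(x)^2}<1-\frac1\alpha .$$ Let $\Psi^*(y)=\sup_{x\in\mathbb R}(xy-\Psi(x))$ be the Legendre transform of $\Psi$. Then $\Psi^*$ is finite on $\mathbb R$, and there exist constants $C,D\in(0,\infty)$ such that, setting $$\mathcal H(t)=C\left(t^2\,\mathbf 1_{|t|<D}+\Psi^*(|t|)\,\mathbf 1_{|t|\ge D}\right),\qquad t\in\mathbb R,$$ one has $\mathcal H\ge 0$ and every locally Lipschitz function $f:\mathbb R\to\mathbb R$ satisfies $$\operatorname{Ent}_{\mu_\Psi}(f^2)\le\int_{\mathbb R}\mathcal H\!\left(\frac{f'}{f}\right)f^2\,d\mu_\Psi ,$$ as an inequality in $[0,\infty]$. Here $\operatorname{Ent}_\mu(g)=\int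 g\log g\,d\mu-\left(\int g\,d\mu\right)\log\left(\int g\,d\mu\right)$ for $g\ge0$ (with $0\log 0=0$), understood as $+\infty$ if $g$ or $g\log g$ is not $\mu$-integrable, $f'$ is the almost everywhere defined derivative of $f$, and the integrand on the right is $0$ at the points where $f=0$. -/

import Mathlib

open MeasureTheory Filter
open scoped ENNReal

/-- The measure `e^{-Ψ(x)} dx` on the real line. -/
noncomputable def muExp (Ψ : ℝ → ℝ) : Measure ℝ :=
  volume.withDensity (fun x => ENNReal.ofReal (Real.exp (-Ψ x)))

/-- The Legendre transform `Ψ*(y) = sup_x (x y - Ψ x)`. It is a supremum in `ℝ`, hence meaningful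
at those `y` for which the family is bounded above. -/
noncomputable def legendreTransform (Ψ : ℝ → ℝ) (y : ℝ) : ℝ :=
  ⨆ x : ℝ, (x * y - Ψ x)

open Classical in
/-- The entropy `∫ g log g dμ - (∫ g dμ) log (∫ g dμ)` of a non-negative function `g` with respect
to a probability measure `μ`, with values in `[0, ∞]`. It is nonnegative by Jensen's inequality, so
that `ENNReal.ofReal` loses nothing; it is `+∞` when `g` or `g log g` is not integrable
(the negative part of `g log g` is bounded). -/
noncomputable def entropy (μ : Measure ℝ) (g : ℝ → ℝ) : ℝ≥0∞ :=
  if Integrable g μ ∧ Integrable (fun x => g x * Real.log (g x)) μ then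
    ENNReal.ofReal
      ((∫ x, g x * Real.log (g x) ∂μ) - (∫ x, g x ∂μ) * Real.log (∫ x, g x ∂μ))
  else ∞

open Classical in
/-- The function `𝓗(t) = C (t² 1_{|t| < D} + Ψ*(|t|) 1_{|t| ≥ D})`. -/
noncomputable def modifiedCost (Ψ : ℝ → ℝ) (C D t : ℝ) : ℝ :=
  C * (if |t| < D then t ^ 2 else legendreTransform Ψ |t|)

/-! By homogeneity, take f ≥ 0 with ∫ f² dμ = 1, and write E for the energy ∫ G(f'/f) f² dμ, where G
is the cost with C = 1. Since G(t) ≥ c t², E controls ∫ f'² dμ, and the Poincaré inequality gives ∫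
(f - 1)² dμ = O(E). Where f ≤ 2, f² log f² is at most f² - 1 + 5 (f - 1)², whose integral is O(E).

Where f > 2, f is replaced by a truncation g that equals f there, vanishes where f ≤ 1, and has mass
m ≤ min(1, O(E)) and energy O(E). Then log g² = log(g² e^{-Ψ}) + Ψ. A one-dimensional Sobolev bound
makes sup g² e^{-Ψ} at most a multiple of m + ∫ g'² dμ, hence O(E). The moment ∫ (Ψ - Ψ 0) g² dμ is
O(E) by a Young inequality for the cost and the Euler inequality x Ψ' ≥ α (Ψ - M), with α > 1
leaving room to absorb.

The Poincaré, Sobolev and moment bounds (`exists_poincare_const`, `exists_sup_bound`,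
`exists_potential_moment_bound`) all come from integrating (φ g² e^{-Ψ})' over [-N, N], with φ a
clamp or the identity. The growth conditions on Ψ enter through `exists_modifiedCost_bounds` and
`euler_inequality`. The cost has growth exponent q = α/(α - 1), and cutting off with the power q/2
keeps the energy of g comparable with E (`ae_cost_upperTruncation_le`). -/

/-! ### Calculus of locally bounded and locally Lipschitz functions. -/

/-- A measurable real function that is bounded on every interval `[-N, N]`. -/
def MeasurableLocBdd (u : ℝ → ℝ) : Prop :=
  Measurable u ∧ ∀ N : ℝ, ∃ K : ℝ, ∀ x ∈ Set.Icc (-N) N, |u x| ≤ K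

namespace MeasurableLocBdd

variable {u v : ℝ → ℝ}

theorem of_continuous (hu : Continuous u) : MeasurableLocBdd u := by
  refine ⟨hu.measurable, fun N => ?_⟩
  obtain ⟨K, hK⟩ := (isCompact_Icc (a := -N) (b := N)).exists_bound_of_continuousOn hu.continuousOn
  exact ⟨K, fun x hx => by simpa using hK x hx⟩

theorem add (hu : MeasurableLocBdd u) (hv : MeasurableLocBdd v) :
    MeasurableLocBdd (fun x => u x + v x) := by
  refine ⟨hu.1.add hv.1, fun N => ?_⟩
  obtain ⟨K, hK⟩ := hu.2 N
  obtain ⟨K', hK'⟩ := hv.2 N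
  exact ⟨K + K', fun x hx => (abs_add_le _ _).trans (add_le_add (hK x hx) (hK' x hx))⟩

theorem mul (hu : MeasurableLocBdd u) (hv : MeasurableLocBdd v) :
    MeasurableLocBdd (fun x => u x * v x) := by
  refine ⟨hu.1.mul hv.1, fun N => ?_⟩
  obtain ⟨K, hK⟩ := hu.2 N
  obtain ⟨K', hK'⟩ := hv.2 N
  refine ⟨K * K', fun x hx => ?_⟩
  rw [abs_mul]
  exact mul_le_mul (hK x hx) (hK' x hx) (abs_nonneg _) ((abs_nonneg _).trans (hK x hx))

theorem const (c : ℝ) : MeasurableLocBdd (fun _ => c) := of_continuous continuous_const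

theorem neg (hu : MeasurableLocBdd u) : MeasurableLocBdd (fun x => -u x) := by
  refine ⟨hu.1.neg, fun N => ?_⟩
  obtain ⟨K, hK⟩ := hu.2 N
  exact ⟨K, fun x hx => by simpa using hK x hx⟩

theorem sub (hu : MeasurableLocBdd u) (hv : MeasurableLocBdd v) :
    MeasurableLocBdd (fun x => u x - v x) := by
  simpa [sub_eq_add_neg] using hu.add hv.neg

theorem pow_two (hu : MeasurableLocBdd u) : MeasurableLocBdd (fun x => u x ^ 2) := by
  simpa [sq] using hu.mul hu

theorem abs (hu : MeasurableLocBdd u) : MeasurableLocBdd (fun x => |u x|) := by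
  refine ⟨hu.1.abs, fun N => ?_⟩
  obtain ⟨K, hK⟩ := hu.2 N
  exact ⟨K, fun x hx => by simpa using hK x hx⟩

theorem intervalIntegrable (hu : MeasurableLocBdd u) (a b : ℝ) :
    IntervalIntegrable u volume a b := by
  obtain ⟨K, hK⟩ := hu.2 (max |a| |b|)
  rw [intervalIntegrable_iff]
  refine Measure.integrableOn_of_bounded (M := K) (by simp) hu.1.aestronglyMeasurable ?_
  refine (ae_restrict_iff' measurableSet_uIoc).2 (Eventually.of_forall fun x hx => ?_)
  refine hK x ?_
  rw [Set.mem_Icc, ← abs_le]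
  rcases Set.mem_uIoc.1 hx with h | h
  · rcases abs_cases x with h1 | h1 <;> rcases abs_cases a with h2 | h2 <;>
      rcases abs_cases b with h3 | h3 <;> simp only [le_max_iff] <;>
      first | (left; linarith) | (right; linarith)
  · rcases abs_cases x with h1 | h1 <;> rcases abs_cases a with h2 | h2 <;>
      rcases abs_cases b with h3 | h3 <;> simp only [le_max_iff] <;>
      first | (left; linarith) | (right; linarith)

end MeasurableLocBdd

namespace LocallyLipschitz

variable {f g : ℝ → ℝ}

theorem exists_lipschitzOnWith_Icc (hf : LocallyLipschitz f) (a b : ℝ) :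
    ∃ K, LipschitzOnWith K f (Set.Icc a b) :=
  LocallyLipschitzOn.exists_lipschitzOnWith_of_compact isCompact_Icc hf.locallyLipschitzOn

theorem absolutelyContinuousOnInterval (hf : LocallyLipschitz f) (a b : ℝ) :
    AbsolutelyContinuousOnInterval f a b := by
  obtain ⟨K, hK⟩ := hf.exists_lipschitzOnWith_Icc (min a b) (max a b)
  exact LipschitzOnWith.absolutelyContinuousOnInterval hK

theorem ae_differentiableAt_real (hf : LocallyLipschitz f) :
    ∀ᵐ x : ℝ, DifferentiableAt ℝ f x := by
  have h : ∀ᵐ x : ℝ, ∀ n : ℕ, x ∈ Set.uIcc (-(n : ℝ)) n → DifferentiableAt ℝ f x :=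
    ae_all_iff.2 fun n => (hf.absolutelyContinuousOnInterval _ _).ae_differentiableAt
  filter_upwards [h] with x hx
  obtain ⟨n, hn⟩ := exists_nat_ge |x|
  refine hx n ?_
  rw [Set.uIcc_of_le (by linarith [(abs_nonneg x)])]
  exact abs_le.1 hn

theorem measurableLocBdd_deriv (hf : LocallyLipschitz f) : MeasurableLocBdd (deriv f) := by
  refine ⟨measurable_deriv f, fun N => ?_⟩
  obtain ⟨K, hK⟩ := hf.exists_lipschitzOnWith_Icc (-N - 1) (N + 1)
  refine ⟨K, fun x hx => ?_⟩
  have := norm_deriv_le_of_lipschitzOn (x₀ := x)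
    (Icc_mem_nhds (by linarith [hx.1]) (by linarith [hx.2])) hK
  simpa using this

theorem integral_deriv (hf : LocallyLipschitz f) (a b : ℝ) :
    ∫ x in a..b, deriv f x = f b - f a :=
  (hf.absolutelyContinuousOnInterval a b).integral_deriv_eq_sub

theorem mul_real (hf : LocallyLipschitz f) (hg : LocallyLipschitz g) :
    LocallyLipschitz (fun x => f x * g x) :=
  (contDiff_mul (𝔸 := ℝ) (𝕜 := ℝ) (n := 1)).locallyLipschitz.comp (hf.prodMk hg)

theorem sq_real (hf : LocallyLipschitz f) : LocallyLipschitz (fun x => f x ^ 2) := by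
  simpa [sq] using hf.mul_real hf

theorem exp_neg (hf : LocallyLipschitz f) : LocallyLipschitz (fun x => Real.exp (-f x)) :=
  ((Real.contDiff_exp.comp contDiff_neg).of_le (by exact_mod_cast le_top)
    : ContDiff ℝ 1 (Real.exp ∘ Neg.neg)).locallyLipschitz.comp hf

theorem rpow_const_real (hf : LocallyLipschitz f) {p : ℝ} (hp : 1 ≤ p) :
    LocallyLipschitz (fun x => f x ^ p) :=
  (Real.contDiff_rpow_const_of_le (n := 1) (by simpa using hp)).locallyLipschitz.comp hf

theorem abs_real (hf : LocallyLipschitz f) : LocallyLipschitz (fun x => |f x|) :=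
  (lipschitzWith_one_norm (E := ℝ)).locallyLipschitz.comp hf

end LocallyLipschitz

/-- The derivative of a function vanishes almost everywhere on each of its level sets. -/
theorem ae_deriv_eq_zero_of_eq (f : ℝ → ℝ) (c : ℝ) : ∀ᵐ x : ℝ, f x = c → deriv f x = 0 := by
  set S : Set ℝ := {x | f x = c ∧ deriv f x ≠ 0} with hS
  -- A nonzero derivative isolates each point within its level set, and a discrete subset of ℝ is
  -- countable, hence null.
  have hd : DiscreteTopology S := by
    refine discreteTopology_subtype_iff.2 fun x hx => ?_
    have h := (differentiableAt_of_deriv_ne_zero hx.2).hasDerivAt.eventually_ne (c := c) hx.2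
    rw [inf_principal_eq_bot]
    filter_upwards [h] with z hz hzS
    exact hz hzS.1
  have hc : S.Countable := by
    have : Countable S := TopologicalSpace.separableSpace_iff_countable.1 inferInstance
    exact this
  have h0 := hc.measure_zero volume
  rw [ae_iff]
  convert h0 using 2
  ext x
  simp [hS]

/-- Cauchy–Schwarz, read off from ∫ (L u - I)² ≥ 0 with L the length and I the integral of u. -/
theorem sq_intervalIntegral_le {u : ℝ → ℝ} {a b : ℝ} (hab : a ≤ b)
    (hu : IntervalIntegrable u volume a b)
    (hu2 : IntervalIntegrable (fun x => u x ^ 2) volume a b) :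
    (∫ x in a..b, u x) ^ 2 ≤ (b - a) * ∫ x in a..b, u x ^ 2 := by
  rcases hab.eq_or_lt with rfl | hlt
  · simp
  set I := ∫ x in a..b, u x with hI
  set L := b - a with hL
  have hLpos : 0 < L := sub_pos.2 hlt
  have h0 : 0 ≤ ∫ x in a..b, (L * u x - I) ^ 2 :=
    intervalIntegral.integral_nonneg hab fun x _ => sq_nonneg _
  have h1 : ∫ x in a..b, (L * u x - I) ^ 2
      = L ^ 2 * (∫ x in a..b, u x ^ 2) - 2 * L * I * I + L * I ^ 2 := by
    have : ∀ x, (L * u x - I) ^ 2 = L ^ 2 * u x ^ 2 - 2 * L * I * u x + I ^ 2 := fun x => by ring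
    simp_rw [this]
    rw [intervalIntegral.integral_add ((hu2.const_mul _).sub (hu.const_mul _)) (by simp),
      intervalIntegral.integral_sub (hu2.const_mul _) (hu.const_mul _),
      intervalIntegral.integral_const_mul, intervalIntegral.integral_const_mul]
    simp [← hI, ← hL]
  rw [h1] at h0
  have : 0 ≤ L * (L * (∫ x in a..b, u x ^ 2) - I ^ 2) := by linarith
  linarith [nonneg_of_mul_nonneg_right this hLpos]

/-! ### Weighted integration by parts and passage from [-N, N] to the line. -/

/-- Integration by parts against the weight `e^{-Ψ}`. -/
theorem integral_by_parts_exp_neg {φ g Ψ : ℝ → ℝ} (hφ : LocallyLipschitz φ)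
    (hg : LocallyLipschitz g) (hΨ : LocallyLipschitz Ψ) (a b : ℝ) :
    ∫ x in a..b, (deriv φ x * g x ^ 2 + 2 * φ x * g x * deriv g x
        - φ x * deriv Ψ x * g x ^ 2) * Real.exp (-Ψ x)
      = φ b * g b ^ 2 * Real.exp (-Ψ b) - φ a * g a ^ 2 * Real.exp (-Ψ a) := by
  have hF : LocallyLipschitz (fun x => φ x * g x ^ 2 * Real.exp (-Ψ x)) :=
    (hφ.mul_real hg.sq_real).mul_real hΨ.exp_neg
  rw [← hF.integral_deriv a b]
  refine intervalIntegral.integral_congr_ae ?_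
  filter_upwards [hφ.ae_differentiableAt_real, hg.ae_differentiableAt_real,
    hΨ.ae_differentiableAt_real] with x h1 h2 h3 _
  have := ((h1.hasDerivAt.mul (h2.hasDerivAt.pow 2)).mul h3.hasDerivAt.neg.exp).deriv
  rw [show deriv (fun x => φ x * g x ^ 2 * Real.exp (-Ψ x)) x = _ from this]
  simp
  ring

/-- Thanks to this, estimates may be proved on finite windows, where everything is integrable, with
integrability on the line as a by-product. -/
theorem integrable_of_forall_intervalIntegral_le {F : ℝ → ℝ} (hF : ∀ x, 0 ≤ F x)
    (hint : ∀ N : ℝ, IntervalIntegrable F volume (-N) N) (B N₀ : ℝ)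
    (h : ∀ N : ℝ, N₀ ≤ N → ∫ x in (-N)..N, F x ≤ B) :
    Integrable F ∧ ∫ x, F x ≤ B := by
  have h1 : Tendsto (fun n : ℕ => -(n : ℝ)) atTop atBot :=
    tendsto_neg_atTop_atBot.comp tendsto_natCast_atTop_atTop
  have h2 : Tendsto (fun n : ℕ => (n : ℝ)) atTop atTop := tendsto_natCast_atTop_atTop
  have hev : ∀ᶠ n : ℕ in atTop, ∫ x in (-(n : ℝ))..n, F x ≤ B := by
    filter_upwards [h2.eventually_ge_atTop N₀] with n hn using h n hn
  have hi : Integrable F := by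
    refine integrable_of_intervalIntegral_norm_bounded (l := atTop) B (fun n : ℕ => ?_) h1 h2 ?_
    · exact (intervalIntegrable_iff_integrableOn_Ioc_of_le
        (by linarith [(Nat.cast_nonneg n : (0 : ℝ) ≤ n)])).1 (hint n)
    · simpa only [Real.norm_of_nonneg (hF _)] using hev
  exact ⟨hi, le_of_tendsto (intervalIntegral_tendsto_integral hi h1 h2) hev⟩

theorem intervalIntegral_le_integral_of_nonneg {F : ℝ → ℝ} (hF : ∀ x, 0 ≤ F x)
    (hi : Integrable F) {a b : ℝ} (hab : a ≤ b) : ∫ x in a..b, F x ≤ ∫ x, F x := by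
  rw [intervalIntegral.integral_of_le hab]
  exact setIntegral_le_integral hi (Eventually.of_forall hF)

theorem LocallyLipschitz.continuous_exp_neg {Ψ : ℝ → ℝ} (h : LocallyLipschitz Ψ) :
    Continuous (fun x => Real.exp (-Ψ x)) := h.exp_neg.continuous

/-! ### Even convex potentials and the clamp multiplier. -/

theorem ConvexOn.add_deriv_mul_sub_le {Ψ : ℝ → ℝ} (hconv : ConvexOn ℝ Set.univ Ψ) {x : ℝ}
    (hx : DifferentiableAt ℝ Ψ x) (y : ℝ) : Ψ x + deriv Ψ x * (y - x) ≤ Ψ y := by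
  rcases lt_trichotomy x y with h | rfl | h
  · have := hconv.deriv_le_slope trivial trivial h hx
    rw [slope_def_field, le_div_iff₀ (sub_pos.2 h)] at this
    linarith
  · simp
  · have := hconv.slope_le_deriv trivial trivial h hx
    rw [slope_def_field, div_le_iff₀ (sub_pos.2 h)] at this
    linarith

theorem Function.Even.le_of_abs_le_abs {Ψ : ℝ → ℝ} (heven : Function.Even Ψ)
    (hconv : ConvexOn ℝ Set.univ Ψ) {x y : ℝ} (h : |x| ≤ |y|) : Ψ x ≤ Ψ y := by
  have hy : Ψ |y| = Ψ y := by
    rcases abs_choice y with h | h <;> rw [h]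
    exact heven y
  have := hconv.le_max_of_mem_Icc (x := -|y|) (y := |y|) (z := x) trivial trivial (abs_le.1 h)
  rwa [heven, max_self, hy] at this

theorem Function.Even.apply_zero_le {Ψ : ℝ → ℝ} (heven : Function.Even Ψ)
    (hconv : ConvexOn ℝ Set.univ Ψ) (x : ℝ) : Ψ 0 ≤ Ψ x :=
  heven.le_of_abs_le_abs hconv (by simp)

/-- The truncation of `x` to `[-R, R]`. -/
def clamp (R x : ℝ) : ℝ := max (-R) (min x R)

theorem lipschitzWith_clamp (R : ℝ) : LipschitzWith 1 (clamp R) :=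
  (LipschitzWith.id.min_const R).const_max (-R)

theorem abs_deriv_clamp_le (R x : ℝ) : |deriv (clamp R) x| ≤ 1 := by
  simpa using norm_deriv_le_of_lipschitz (x₀ := x) (lipschitzWith_clamp R)

theorem deriv_clamp_of_lt_abs {R x : ℝ} (hR : 0 < R) (hx : R < |x|) : deriv (clamp R) x = 0 := by
  rcases lt_abs.1 hx with h | h
  · have : clamp R =ᶠ[nhds x] fun _ => R := by
      filter_upwards [lt_mem_nhds h] with y hy
      rw [clamp, min_eq_right hy.le, max_eq_right (by linarith)]
    simp [this.deriv_eq]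
  · have : clamp R =ᶠ[nhds x] fun _ => -R := by
      filter_upwards [gt_mem_nhds (show x < -R by linarith)] with y hy
      rw [clamp, min_eq_left (by linarith), max_eq_left (by linarith)]
    simp [this.deriv_eq]

theorem clamp_of_abs_le {R x : ℝ} (hx : |x| ≤ R) : clamp R x = x := by
  rw [abs_le] at hx
  rw [clamp, min_eq_left hx.2, max_eq_right hx.1]

theorem clamp_of_le {R x : ℝ} (hR : 0 < R) (hx : R ≤ x) : clamp R x = R := by
  rw [clamp, min_eq_right hx, max_eq_right (by linarith)]

theorem clamp_of_le_neg {R x : ℝ} (hR : 0 < R) (hx : x ≤ -R) : clamp R x = -R := by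
  rw [clamp, min_eq_left (by linarith), max_eq_left hx]

theorem abs_clamp_le {R : ℝ} (hR : 0 < R) (x : ℝ) : |clamp R x| ≤ R := by
  rw [abs_le, clamp]
  exact ⟨le_max_left _ _, max_le (by linarith) (min_le_right _ _)⟩

/-- The signs of φ at the endpoints make both boundary terms favourable, so g needs no decay at
infinity. -/
theorem integral_by_parts_exp_neg_nonneg {φ g Ψ : ℝ → ℝ} (hφ : LocallyLipschitz φ)
    (hg : LocallyLipschitz g) (hΨ : LocallyLipschitz Ψ) {N : ℝ} (h1 : 0 ≤ φ N) (h2 : φ (-N) ≤ 0) :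
    0 ≤ ∫ x in (-N)..N, (deriv φ x * g x ^ 2 + 2 * φ x * g x * deriv g x
        - φ x * deriv Ψ x * g x ^ 2) * Real.exp (-Ψ x) := by
  rw [integral_by_parts_exp_neg hφ hg hΨ]
  have := mul_nonneg (mul_nonneg h1 (sq_nonneg (g N))) (Real.exp_pos (-Ψ N)).le
  have := mul_nonneg (mul_nonneg (neg_nonneg.2 h2) (sq_nonneg (g (-N)))) (Real.exp_pos (-Ψ (-N))).le
  linarith

theorem measurableLocBdd_by_parts {φ g Ψ : ℝ → ℝ} (hφ : LocallyLipschitz φ)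
    (hg : LocallyLipschitz g) (hΨ : LocallyLipschitz Ψ) :
    MeasurableLocBdd (fun x => (deriv φ x * g x ^ 2 + 2 * φ x * g x * deriv g x
        - φ x * deriv Ψ x * g x ^ 2) * Real.exp (-Ψ x)) := by
  have b1 := MeasurableLocBdd.of_continuous hφ.continuous
  have b2 := MeasurableLocBdd.of_continuous hg.continuous
  have b3 := MeasurableLocBdd.of_continuous hΨ.continuous_exp_neg
  exact (((hφ.measurableLocBdd_deriv.mul b2.pow_two).add
    ((((MeasurableLocBdd.const 2).mul b1).mul b2).mul hg.measurableLocBdd_deriv)).sub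
    ((b1.mul hΨ.measurableLocBdd_deriv).mul b2.pow_two)).mul b3

/-- A function `Ψ` with integrable weight `e^{-Ψ}` is not bounded above. -/
theorem exists_lt_of_integrable_exp_neg {Ψ : ℝ → ℝ} (hint : Integrable (fun x => Real.exp (-Ψ x))) (c : ℝ) :
    ∃ x : ℝ, c < Ψ x := by
  by_contra! h
  have : Integrable (fun _ : ℝ => Real.exp (-c)) := by
    refine hint.mono' (by fun_prop) (Eventually.of_forall fun x => ?_)
    rw [Real.norm_of_nonneg (Real.exp_pos _).le]
    exact Real.exp_le_exp.2 (neg_le_neg (h x))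
  rw [integrable_const_iff] at this
  rcases this with h | h
  · exact (Real.exp_pos _).ne' h
  · simpa using (h.measure_univ_lt_top).ne

/-- Fundamental theorem of calculus and Cauchy–Schwarz between 0 and x, where the weight is at least
e^{-Ψ R}. This handles the core |x| ≤ R of the Poincaré inequality. -/
theorem sq_sub_apply_zero_le {Ψ f : ℝ → ℝ} (heven : Function.Even Ψ)
    (hconv : ConvexOn ℝ Set.univ Ψ) (hf : LocallyLipschitz f) {R N : ℝ}
    (hRN : R ≤ N) {x : ℝ} (hx : |x| ≤ R) :
    (f x - f 0) ^ 2 ≤ R * Real.exp (Ψ R) *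
      ∫ y in (-N)..N, deriv f y ^ 2 * Real.exp (-Ψ y) := by
  have hR : 0 ≤ R := (abs_nonneg x).trans hx
  have hΨ := hconv.locallyLipschitz
  have bd := hf.measurableLocBdd_deriv
  have bw := MeasurableLocBdd.of_continuous hΨ.continuous_exp_neg
  have key : ∀ a b : ℝ, a ≤ b → -R ≤ a → b ≤ R → b - a ≤ R →
      (f b - f a) ^ 2 ≤ R * Real.exp (Ψ R) *
        ∫ y in (-N)..N, deriv f y ^ 2 * Real.exp (-Ψ y) := by
    intro a b hab ha hb hba
    rw [← hf.integral_deriv a b]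
    refine (sq_intervalIntegral_le hab (bd.intervalIntegrable _ _)
      (bd.pow_two.intervalIntegrable _ _)).trans ?_
    rw [mul_assoc]
    refine mul_le_mul hba ?_ (intervalIntegral.integral_nonneg hab fun _ _ => sq_nonneg _) hR
    rw [← intervalIntegral.integral_const_mul]
    have i1 := ((MeasurableLocBdd.const (Real.exp (Ψ R))).mul (bd.pow_two.mul bw))
    calc ∫ y in a..b, deriv f y ^ 2
        ≤ ∫ y in a..b, Real.exp (Ψ R) * (deriv f y ^ 2 * Real.exp (-Ψ y)) := by
          refine intervalIntegral.integral_mono_on hab (bd.pow_two.intervalIntegrable _ _)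
            (i1.intervalIntegrable _ _) fun y hy => ?_
          have h1 : Ψ y ≤ Ψ R := heven.le_of_abs_le_abs hconv (by
            rw [abs_of_nonneg hR]
            exact abs_le.2 ⟨ha.trans hy.1, hy.2.trans hb⟩)
          have h2 : 1 ≤ Real.exp (Ψ R) * Real.exp (-Ψ y) := by
            rw [← Real.exp_add]
            exact Real.one_le_exp (by linarith)
          nlinarith [sq_nonneg (deriv f y)]
      _ ≤ _ := by
          refine intervalIntegral.integral_mono_interval (by linarith) hab (by linarith)
            (Eventually.of_forall fun y => ?_) (i1.intervalIntegrable _ _)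
          positivity
  rw [abs_le] at hx
  rcases le_total 0 x with h | h
  · exact key 0 x h (by linarith) hx.2 (by linarith)
  · rw [show (f x - f 0) ^ 2 = (f 0 - f x) ^ 2 by ring]
    exact key x 0 h hx.1 hR (by linarith)

/-! ### Poincaré inequality. -/

/-- A Poincaré inequality for even log-concave probability densities on the line. -/
theorem exists_poincare_const {Ψ : ℝ → ℝ} (heven : Function.Even Ψ)
    (hconv : ConvexOn ℝ Set.univ Ψ) (hint : Integrable (fun x => Real.exp (-Ψ x)))
    (hone : ∫ x, Real.exp (-Ψ x) = 1) :
    ∃ C : ℝ, 0 < C ∧ ∀ f : ℝ → ℝ, LocallyLipschitz f →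
      Integrable (fun x => deriv f x ^ 2 * Real.exp (-Ψ x)) →
      Integrable (fun x => (f x - f 0) ^ 2 * Real.exp (-Ψ x)) ∧
      ∫ x, (f x - f 0) ^ 2 * Real.exp (-Ψ x) ≤ C * ∫ x, deriv f x ^ 2 * Real.exp (-Ψ x) := by
  have hΨ := hconv.locallyLipschitz
  obtain ⟨R₀, hR₀⟩ := exists_lt_of_integrable_exp_neg hint (Ψ 0)
  obtain ⟨R, hR, hκ⟩ : ∃ R : ℝ, 0 < R ∧ Ψ 0 < Ψ R := by
    refine ⟨|R₀|, abs_pos.2 fun h => ?_, hR₀.trans_le (heven.le_of_abs_le_abs hconv (by simp))⟩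
    rw [h] at hR₀
    exact lt_irrefl _ hR₀
  set κ := Ψ R - Ψ 0 with hκdef
  have hκ : 0 < κ := sub_pos.2 hκ
  set A := 2 * R ^ 2 / κ + (1 + κ) * (R * Real.exp (Ψ R)) with hA
  have hApos : 0 < A := by positivity
  refine ⟨2 / κ * A, by positivity, fun f hf hf2 => ?_⟩
  set h : ℝ → ℝ := fun x => f x - f 0 with hh
  have hhl : LocallyLipschitz h := by
    simpa [hh, sub_eq_add_neg] using hf.add (LocallyLipschitz.const (-f 0))
  have hhd : ∀ x, deriv h x = deriv f x := fun x => by simp [hh]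
  have bd := hf.measurableLocBdd_deriv
  have bh := MeasurableLocBdd.of_continuous hhl.continuous
  have bw := MeasurableLocBdd.of_continuous hΨ.continuous_exp_neg
  have hnn : ∀ x, 0 ≤ h x ^ 2 * Real.exp (-Ψ x) := fun x => by positivity
  refine integrable_of_forall_intervalIntegral_le hnn
    (fun N => (bh.pow_two.mul bw).intervalIntegrable _ _) _ R fun N hN => ?_
  set J := ∫ y in (-N)..N, deriv f y ^ 2 * Real.exp (-Ψ y) with hJ
  have hNN : -N ≤ N := by linarith
  have hJ0 : 0 ≤ J := intervalIntegral.integral_nonneg hNN fun y _ => by positivity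
  have hJle : J ≤ ∫ x, deriv f x ^ 2 * Real.exp (-Ψ x) :=
    intervalIntegral_le_integral_of_nonneg (fun x => by positivity) hf2 hNN
  have hcl := (lipschitzWith_clamp R).locallyLipschitz
  have h0 := integral_by_parts_exp_neg_nonneg hcl hhl hΨ (N := N)
    (by rw [clamp_of_le hR hN]; exact hR.le) (by rw [clamp_of_le_neg hR (by linarith)]; linarith)
  have hW : ∫ x in (-N)..N, Real.exp (-Ψ x) ≤ 1 := by
    rw [← hone]
    exact intervalIntegral_le_integral_of_nonneg (fun x => by positivity) hint hNN
  set E := (1 + κ) * (R * Real.exp (Ψ R) * J) with hE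
  have hE0 : 0 ≤ E := by positivity
  have bound : ∀ᵐ x : ℝ,
      (deriv (clamp R) x * h x ^ 2 + 2 * clamp R x * h x * deriv h x
        - clamp R x * deriv Ψ x * h x ^ 2) * Real.exp (-Ψ x)
      ≤ -(κ / 2) * (h x ^ 2 * Real.exp (-Ψ x))
        + 2 * R ^ 2 / κ * (deriv f x ^ 2 * Real.exp (-Ψ x)) + E * Real.exp (-Ψ x) := by
    filter_upwards [hΨ.ae_differentiableAt_real] with x hx
    suffices H : deriv (clamp R) x * h x ^ 2 + 2 * clamp R x * h x * deriv h x
        - clamp R x * deriv Ψ x * h x ^ 2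
        ≤ -(κ / 2) * h x ^ 2 + 2 * R ^ 2 / κ * deriv f x ^ 2 + E by
      have := mul_le_mul_of_nonneg_right H (Real.exp_pos (-Ψ x)).le
      linarith
    rw [hhd]
    have htan := hconv.add_deriv_mul_sub_le hx 0
    have hcross : 2 * clamp R x * h x * deriv f x
        ≤ κ / 2 * h x ^ 2 + 2 * R ^ 2 / κ * deriv f x ^ 2 := by
      have h1 : clamp R x ^ 2 ≤ R ^ 2 := sq_le_sq' (abs_le.1 (abs_clamp_le hR x)).1
        (abs_le.1 (abs_clamp_le hR x)).2
      have h2 : 2 * clamp R x * h x * deriv f x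
          ≤ κ / 2 * h x ^ 2 + 2 * clamp R x ^ 2 / κ * deriv f x ^ 2 := by
        have : 0 ≤ (κ * h x - 2 * clamp R x * deriv f x) ^ 2 / (2 * κ) := by positivity
        have e : (κ * h x - 2 * clamp R x * deriv f x) ^ 2 / (2 * κ)
            = κ / 2 * h x ^ 2 + 2 * clamp R x ^ 2 / κ * deriv f x ^ 2
              - 2 * clamp R x * h x * deriv f x := by
          field_simp
          ring
        linarith
      have h3 : 2 * clamp R x ^ 2 / κ * deriv f x ^ 2 ≤ 2 * R ^ 2 / κ * deriv f x ^ 2 := by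
        gcongr
      linarith
    rcases le_or_gt |x| R with hxR | hxR
    · have h1 := sq_sub_apply_zero_le heven hconv hf hN hxR
      -- In the core there is no useful drift: one copy of h² pays for the derivative of the clamp,
      -- and κ h² pays for the cross term and for the -(κ/2) h² claimed on the right.
      have h2 : (1 + κ) * h x ^ 2 ≤ E := mul_le_mul_of_nonneg_left h1 (by linarith)
      have h3 : deriv (clamp R) x * h x ^ 2 ≤ 1 * h x ^ 2 :=
        mul_le_mul_of_nonneg_right (abs_le.1 (abs_deriv_clamp_le R x)).2 (sq_nonneg _)
      have h4 : 0 ≤ clamp R x * deriv Ψ x * h x ^ 2 := by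
        refine mul_nonneg ?_ (sq_nonneg _)
        rw [clamp_of_abs_le hxR]
        linarith [heven.apply_zero_le hconv x]
      linarith
    · have h1 := deriv_clamp_of_lt_abs hR hxR
      -- Outside the core the drift supplies κ: the tangent at x evaluated at 0 gives x Ψ' x ≥ Ψ x -
      -- Ψ 0, and convexity on [0, |x|] gives (R/|x|)(Ψ x - Ψ 0) ≥ Ψ R - Ψ 0.
      have h2 : κ ≤ clamp R x * deriv Ψ x := by
        have hx0 : 0 < |x| := hR.trans hxR
        have hc : clamp R x = R / |x| * x := by
          rcases abs_cases x with ⟨e, hs⟩ | ⟨e, hs⟩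
          · rw [clamp_of_le hR (by linarith), e, div_mul_cancel₀ _ (by linarith)]
          · rw [clamp_of_le_neg hR (by linarith), e]
            have : x ≠ 0 := hs.ne
            field_simp
        have ht1 : R / |x| ≤ 1 := (div_le_one hx0).2 hxR.le
        have ht0 : 0 ≤ R / |x| := by positivity
        have hcv := hconv.2 (x := |x|) (y := 0) trivial trivial ht0 (sub_nonneg.2 ht1) (by ring)
        simp only [smul_eq_mul, mul_zero, add_zero] at hcv
        rw [div_mul_cancel₀ _ hx0.ne'] at hcv
        have he : Ψ |x| ≤ Ψ x := heven.le_of_abs_le_abs hconv (by simp)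
        rw [hc, mul_assoc]
        have : R / |x| * (Ψ x - Ψ 0) ≤ R / |x| * (x * deriv Ψ x) :=
          mul_le_mul_of_nonneg_left (by linarith) ht0
        nlinarith
      have h3 : κ * h x ^ 2 ≤ clamp R x * deriv Ψ x * h x ^ 2 :=
        mul_le_mul_of_nonneg_right h2 (sq_nonneg _)
      rw [h1]
      linarith
  have i1 := ((bh.pow_two.mul bw).intervalIntegrable (-N) N).const_mul (-(κ / 2))
  have i2 := ((bd.pow_two.mul bw).intervalIntegrable (-N) N).const_mul (2 * R ^ 2 / κ)
  have i3 := (bw.intervalIntegrable (-N) N).const_mul E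
  have hle := intervalIntegral.integral_mono_ae hNN
    ((measurableLocBdd_by_parts hcl hhl hΨ).intervalIntegrable _ _) ((i1.add i2).add i3) bound
  rw [intervalIntegral.integral_add (i1.add i2) i3, intervalIntegral.integral_add i1 i2,
    intervalIntegral.integral_const_mul, intervalIntegral.integral_const_mul,
    intervalIntegral.integral_const_mul] at hle
  have hEW := mul_le_mul_of_nonneg_left hW hE0
  have hfin : κ / 2 * ∫ x in (-N)..N, h x ^ 2 * Real.exp (-Ψ x) ≤ A * J := by
    rw [hA, add_mul]
    linarith
  have : ∫ x in (-N)..N, h x ^ 2 * Real.exp (-Ψ x) ≤ 2 / κ * (A * J) := by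
    rw [div_mul_eq_mul_div, le_div_iff₀ hκ]
    linarith
  refine this.trans ?_
  rw [mul_assoc]
  gcongr

/-! ### One-dimensional Sobolev bound. -/

theorem abs_deriv_le_of_abs_le_one {Ψ : ℝ → ℝ} (heven : Function.Even Ψ)
    (hconv : ConvexOn ℝ Set.univ Ψ) {x : ℝ} (hx : DifferentiableAt ℝ Ψ x) (h1 : |x| ≤ 1) :
    |deriv Ψ x| ≤ Ψ 2 - Ψ 0 := by
  have h0 := heven.apply_zero_le hconv x
  rw [abs_le] at h1
  have hp : Ψ (x + 1) ≤ Ψ 2 := heven.le_of_abs_le_abs hconv (by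
    rw [abs_of_pos (by norm_num : (0 : ℝ) < 2)]; exact abs_le.2 ⟨by linarith, by linarith⟩)
  have hm : Ψ (x - 1) ≤ Ψ 2 := heven.le_of_abs_le_abs hconv (by
    rw [abs_of_pos (by norm_num : (0 : ℝ) < 2)]; exact abs_le.2 ⟨by linarith, by linarith⟩)
  have h2 := hconv.add_deriv_mul_sub_le hx (x + 1)
  have h3 := hconv.add_deriv_mul_sub_le hx (x - 1)
  rw [abs_le]
  constructor <;> linarith

/-- A one-dimensional Sobolev bound for the density `g² e^{-Ψ}`. -/
theorem exists_sup_bound {Ψ : ℝ → ℝ} (heven : Function.Even Ψ) (hconv : ConvexOn ℝ Set.univ Ψ) :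
    ∃ B : ℝ, 0 < B ∧ ∀ g : ℝ → ℝ, LocallyLipschitz g →
      Integrable (fun x => g x ^ 2 * Real.exp (-Ψ x)) →
      Integrable (fun x => deriv g x ^ 2 * Real.exp (-Ψ x)) → ∀ x,
      g x ^ 2 * Real.exp (-Ψ x) ≤
        B * ((∫ x, g x ^ 2 * Real.exp (-Ψ x)) + ∫ x, deriv g x ^ 2 * Real.exp (-Ψ x)) := by
  have hΨ := hconv.locallyLipschitz
  set L := Ψ 2 - Ψ 0 with hL
  have hL0 : 0 ≤ L := sub_nonneg.2 (heven.apply_zero_le hconv 2)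
  refine ⟨4 + L, by linarith, fun g hg hi hi' x => ?_⟩
  set m := ∫ x, g x ^ 2 * Real.exp (-Ψ x) with hm
  set m' := ∫ x, deriv g x ^ 2 * Real.exp (-Ψ x) with hm'
  have hm0 : 0 ≤ m := integral_nonneg fun x => by positivity
  have hm0' : 0 ≤ m' := integral_nonneg fun x => by positivity
  -- The window must contain x and [0, 1], and reach the region where the clamp is ±1.
  set N := max 1 |x| with hN
  have hN1 : 1 ≤ N := le_max_left _ _
  have hxN := abs_le.1 (le_max_right 1 |x| : |x| ≤ N)
  have hNN : -N ≤ N := by linarith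
  have hcl := (lipschitzWith_clamp 1).locallyLipschitz
  have h0 := integral_by_parts_exp_neg_nonneg hcl hg hΨ (N := N)
    (by rw [clamp_of_le one_pos hN1]; exact zero_le_one)
    (by rw [clamp_of_le_neg one_pos (by linarith)]; linarith)
  set v : ℝ → ℝ := fun y => g y ^ 2 * Real.exp (-Ψ y) with hv
  have hvl : LocallyLipschitz v := hg.sq_real.mul_real hΨ.exp_neg
  have ivd := hvl.measurableLocBdd_deriv
  have i1 : IntervalIntegrable v volume (-N) N := hi.intervalIntegrable
  have i2 : IntervalIntegrable (fun x => deriv g x ^ 2 * Real.exp (-Ψ x)) volume (-N) N :=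
    hi'.intervalIntegrable
  have i3 := (measurableLocBdd_by_parts hcl hg hΨ).intervalIntegrable (-N) N
  -- The subtracted integrand has nonnegative integral, so it disappears afterwards; its part `clamp
  -- 1 y * deriv Ψ y * g y ^ 2`, up to L g², dominates the drift term |Ψ'| g² of |v'|.
  have bound : ∀ᵐ y : ℝ, |deriv v y| ≤ (3 + L) * v y
      + 2 * (deriv g y ^ 2 * Real.exp (-Ψ y))
      - (deriv (clamp 1) y * g y ^ 2 + 2 * clamp 1 y * g y * deriv g y
        - clamp 1 y * deriv Ψ y * g y ^ 2) * Real.exp (-Ψ y) := by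
    filter_upwards [hΨ.ae_differentiableAt_real, hg.ae_differentiableAt_real] with y h1 h2
    have hd : deriv v y = (2 * g y * deriv g y - deriv Ψ y * g y ^ 2) * Real.exp (-Ψ y) := by
      have := ((h2.hasDerivAt.pow 2).mul h1.hasDerivAt.neg.exp).deriv
      rw [show deriv v y = _ from this]
      simp
      ring
    rw [hd, abs_mul, abs_of_pos (Real.exp_pos _)]
    suffices H : |2 * g y * deriv g y - deriv Ψ y * g y ^ 2| ≤ (3 + L) * g y ^ 2
        + 2 * deriv g y ^ 2 - (deriv (clamp 1) y * g y ^ 2 + 2 * clamp 1 y * g y * deriv g y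
        - clamp 1 y * deriv Ψ y * g y ^ 2) by
      have := mul_le_mul_of_nonneg_right H (Real.exp_pos (-Ψ y)).le
      simp only [hv]
      linarith
    have e1 : |deriv Ψ y| ≤ clamp 1 y * deriv Ψ y + L := by
      have htan := hconv.add_deriv_mul_sub_le h1 0
      have hmin := heven.apply_zero_le hconv y
      have hyd : 0 ≤ y * deriv Ψ y := by linarith
      rcases le_or_gt |y| 1 with h | h
      · rw [clamp_of_abs_le h]
        linarith [abs_deriv_le_of_abs_le_one heven hconv h1 h]
      · rcases lt_abs.1 h with h | h
        · rw [clamp_of_le one_pos h.le, abs_of_nonneg (nonneg_of_mul_nonneg_right hyd (by linarith))]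
          linarith
        · have : deriv Ψ y ≤ 0 := by
            by_contra! hc
            nlinarith
          rw [clamp_of_le_neg one_pos (by linarith), abs_of_nonpos this]
          linarith
    have e2 : |2 * g y * deriv g y| ≤ g y ^ 2 + deriv g y ^ 2 := by
      rw [abs_le]
      constructor <;> nlinarith [sq_nonneg (g y + deriv g y), sq_nonneg (g y - deriv g y)]
    have e3 : 2 * clamp 1 y * g y * deriv g y ≤ g y ^ 2 + deriv g y ^ 2 := by
      have : 2 * clamp 1 y * g y * deriv g y ≤ |clamp 1 y| * |2 * g y * deriv g y| := by
        rw [← abs_mul]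
        refine le_trans (le_of_eq (by ring)) (le_abs_self _)
      refine this.trans ?_
      calc |clamp 1 y| * |2 * g y * deriv g y| ≤ 1 * |2 * g y * deriv g y| :=
            mul_le_mul_of_nonneg_right (abs_clamp_le one_pos y) (abs_nonneg _)
        _ ≤ _ := by linarith
    have e4 : deriv (clamp 1) y * g y ^ 2 ≤ 1 * g y ^ 2 :=
      mul_le_mul_of_nonneg_right (abs_le.1 (abs_deriv_clamp_le 1 y)).2 (sq_nonneg _)
    have e5 : |deriv Ψ y * g y ^ 2| ≤ (clamp 1 y * deriv Ψ y + L) * g y ^ 2 := by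
      rw [abs_mul, abs_of_nonneg (sq_nonneg (g y))]
      exact mul_le_mul_of_nonneg_right e1 (sq_nonneg _)
    have e6 := abs_sub (2 * g y * deriv g y) (deriv Ψ y * g y ^ 2)
    linarith
  have hT : ∫ y in (-N)..N, |deriv v y| ≤ (3 + L) * m + 2 * m' := by
    have hle := intervalIntegral.integral_mono_ae hNN (ivd.abs.intervalIntegrable _ _)
      (((i1.const_mul (3 + L)).add (i2.const_mul 2)).sub i3) bound
    rw [intervalIntegral.integral_sub ((i1.const_mul (3 + L)).add (i2.const_mul 2)) i3,
      intervalIntegral.integral_add (i1.const_mul (3 + L)) (i2.const_mul 2),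
      intervalIntegral.integral_const_mul, intervalIntegral.integral_const_mul] at hle
    have j1 : ∫ y in (-N)..N, v y ≤ m :=
      intervalIntegral_le_integral_of_nonneg (fun x => by positivity) hi hNN
    have j2 : ∫ y in (-N)..N, deriv g y ^ 2 * Real.exp (-Ψ y) ≤ m' :=
      intervalIntegral_le_integral_of_nonneg (fun x => by positivity) hi' hNN
    have := mul_le_mul_of_nonneg_left j1 (by linarith : 0 ≤ 3 + L)
    linarith
  -- The total variation bounds v x - v y; averaging over y ∈ [0, 1] then replaces v y by the mass.
  have hdiff : ∀ y ∈ Set.Icc (0 : ℝ) 1, v x ≤ v y + ((3 + L) * m + 2 * m') := by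
    intro y hy
    have h1 : v x - v y ≤ |∫ z in y..x, deriv v z| := by
      rw [hvl.integral_deriv]
      exact le_abs_self _
    have h2 : |∫ z in y..x, deriv v z| ≤ ∫ z in (-N)..N, |deriv v z| := by
      rw [← Real.norm_eq_abs]
      refine (intervalIntegral.norm_integral_le_integral_norm_uIoc).trans ?_
      rw [intervalIntegral.integral_of_le hNN]
      refine setIntegral_mono_set
        ((intervalIntegrable_iff_integrableOn_Ioc_of_le hNN).1 (ivd.abs.intervalIntegrable _ _))
        (Eventually.of_forall fun z => abs_nonneg _) (LE.le.eventuallyLE ?_)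
      refine Set.Ioc_subset_Ioc (le_min (by linarith [hy.1]) hxN.1) (max_le (by linarith [hy.2]) hxN.2)
    linarith
  have i01 : IntervalIntegrable v volume 0 1 := hi.intervalIntegrable
  have hfin := intervalIntegral.integral_mono_on (zero_le_one (α := ℝ))
    (intervalIntegrable_const (μ := volume) (c := v x)) (i01.add intervalIntegrable_const) hdiff
  rw [intervalIntegral.integral_add i01 intervalIntegrable_const] at hfin
  simp only [intervalIntegral.integral_const, sub_zero, one_smul] at hfin
  have j1 : ∫ y in (0 : ℝ)..1, v y ≤ m :=
    intervalIntegral_le_integral_of_nonneg (fun x => by positivity) hi zero_le_one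
  change v x ≤ _
  nlinarith

/-! ### Moment of the potential. -/

/-- A Young inequality for the cost `G` and an Euler inequality for `Ψ` together control
the `Ψ`-moment of `g² e^{-Ψ}`. -/
theorem exists_potential_moment_bound {Ψ G : ℝ → ℝ} (heven : Function.Even Ψ)
    (hconv : ConvexOn ℝ Set.univ Ψ) (hG : ∀ t, 0 ≤ G t) {α M K C : ℝ} (hα : 1 < α) (hC : 0 ≤ C)
    (heuler : ∀ᵐ x : ℝ, α * (Ψ x - M) ≤ x * deriv Ψ x)
    (hyoung : ∀ x t : ℝ, 2 * |x| * |t| ≤ Ψ x + K + C * G t) :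
    ∃ A : ℝ, 0 < A ∧ ∀ g : ℝ → ℝ, LocallyLipschitz g →
      Integrable (fun x => g x ^ 2 * Real.exp (-Ψ x)) →
      Integrable (fun x => G (deriv g x / g x) * g x ^ 2 * Real.exp (-Ψ x)) →
      Integrable (fun x => (Ψ x - Ψ 0) * g x ^ 2 * Real.exp (-Ψ x)) ∧
      ∫ x, (Ψ x - Ψ 0) * g x ^ 2 * Real.exp (-Ψ x) ≤
        A * ((∫ x, g x ^ 2 * Real.exp (-Ψ x))
          + ∫ x, G (deriv g x / g x) * g x ^ 2 * Real.exp (-Ψ x)) := by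
  have hΨ := hconv.locallyLipschitz
  set K' := |1 + K + α * M - (α - 1) * Ψ 0| with hK'
  have hα' : 0 < α - 1 := sub_pos.2 hα
  refine ⟨(K' + C + 1) / (α - 1), by positivity, fun g hg hi hiG => ?_⟩
  set m := ∫ x, g x ^ 2 * Real.exp (-Ψ x) with hm
  set e := ∫ x, G (deriv g x / g x) * g x ^ 2 * Real.exp (-Ψ x) with he
  have hm0 : 0 ≤ m := integral_nonneg fun x => by positivity
  have hnG : ∀ x, 0 ≤ G (deriv g x / g x) * g x ^ 2 * Real.exp (-Ψ x) := fun x =>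
    mul_nonneg (mul_nonneg (hG _) (sq_nonneg _)) (Real.exp_pos _).le
  have he0 : 0 ≤ e := integral_nonneg hnG
  have bΨ := (MeasurableLocBdd.of_continuous hΨ.continuous).sub (MeasurableLocBdd.const (Ψ 0))
  have bg := MeasurableLocBdd.of_continuous hg.continuous
  have bw := MeasurableLocBdd.of_continuous hΨ.continuous_exp_neg
  have hnn : ∀ x, 0 ≤ (Ψ x - Ψ 0) * g x ^ 2 * Real.exp (-Ψ x) := fun x =>
    mul_nonneg (mul_nonneg (sub_nonneg.2 (heven.apply_zero_le hconv x)) (sq_nonneg _))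
      (Real.exp_pos _).le
  refine integrable_of_forall_intervalIntegral_le hnn
    (fun N => ((bΨ.mul bg.pow_two).mul bw).intervalIntegrable _ _) _ 0 fun N hN => ?_
  have hNN : -N ≤ N := by linarith
  have h0 := integral_by_parts_exp_neg_nonneg (φ := id) LocallyLipschitz.id hg hΨ (N := N) hN
    (by simpa using hN)
  have i0 : IntervalIntegrable (fun x => g x ^ 2 * Real.exp (-Ψ x)) volume (-N) N :=
    hi.intervalIntegrable
  have iG : IntervalIntegrable (fun x => G (deriv g x / g x) * g x ^ 2 * Real.exp (-Ψ x))
    volume (-N) N := hiG.intervalIntegrable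
  have iΨ := (((bΨ.mul bg.pow_two).mul bw).intervalIntegrable (-N) N).const_mul (α - 1)
  -- With φ the identity, the cross term costs one Ψ g² by Young while the drift yields α Ψ g² by
  -- Euler; the surplus α - 1 > 0 is the moment to be bounded.
  have bound : ∀ᵐ x : ℝ, (deriv id x * g x ^ 2 + 2 * id x * g x * deriv g x
        - id x * deriv Ψ x * g x ^ 2) * Real.exp (-Ψ x)
      ≤ K' * (g x ^ 2 * Real.exp (-Ψ x))
        + C * (G (deriv g x / g x) * g x ^ 2 * Real.exp (-Ψ x))
        - (α - 1) * ((Ψ x - Ψ 0) * g x ^ 2 * Real.exp (-Ψ x)) := by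
    filter_upwards [heuler] with x hx
    suffices H : g x ^ 2 + 2 * x * g x * deriv g x - x * deriv Ψ x * g x ^ 2
        ≤ K' * g x ^ 2 + C * (G (deriv g x / g x) * g x ^ 2)
          - (α - 1) * ((Ψ x - Ψ 0) * g x ^ 2) by
      have := mul_le_mul_of_nonneg_right H (Real.exp_pos (-Ψ x)).le
      simp only [deriv_id, id, one_mul]
      linarith
    have h1 : 2 * x * g x * deriv g x ≤ (Ψ x + K + C * G (deriv g x / g x)) * g x ^ 2 := by
      rcases eq_or_ne (g x) 0 with hg0 | hg0
      · simp [hg0]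
      · have := mul_le_mul_of_nonneg_right (hyoung x (deriv g x / g x)) (sq_nonneg (g x))
        refine le_trans ?_ this
        have e : 2 * x * g x * deriv g x = 2 * (x * (deriv g x / g x)) * g x ^ 2 := by
          field_simp
        rw [e, mul_assoc 2 |x|, ← abs_mul]
        gcongr
        exact le_abs_self _
    have h2 := mul_le_mul_of_nonneg_right hx (sq_nonneg (g x))
    have h3 := mul_le_mul_of_nonneg_right (le_abs_self (1 + K + α * M - (α - 1) * Ψ 0))
      (sq_nonneg (g x))
    rw [← hK'] at h3
    linarith
  have hle := intervalIntegral.integral_mono_ae hNN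
    ((measurableLocBdd_by_parts LocallyLipschitz.id hg hΨ).intervalIntegrable _ _)
    (((i0.const_mul K').add (iG.const_mul C)).sub iΨ) bound
  rw [intervalIntegral.integral_sub ((i0.const_mul K').add (iG.const_mul C)) iΨ,
    intervalIntegral.integral_add (i0.const_mul K') (iG.const_mul C),
    intervalIntegral.integral_const_mul, intervalIntegral.integral_const_mul,
    intervalIntegral.integral_const_mul] at hle
  have j1 : ∫ y in (-N)..N, g y ^ 2 * Real.exp (-Ψ y) ≤ m :=
    intervalIntegral_le_integral_of_nonneg (fun x => by positivity) hi hNN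
  have j2 : ∫ x in (-N)..N, G (deriv g x / g x) * g x ^ 2 * Real.exp (-Ψ x) ≤ e :=
    intervalIntegral_le_integral_of_nonneg hnG hiG hNN
  have hK0 : 0 ≤ K' := abs_nonneg _
  have j3 := mul_le_mul_of_nonneg_left j1 hK0
  have j4 := mul_le_mul_of_nonneg_left j2 hC
  rw [div_mul_eq_mul_div, le_div_iff₀ hα']
  have : 0 ≤ K' * e + C * m + (m + e) := by positivity
  linarith

/-! ### Legendre transform, growth of the cost, Euler inequality. -/

section Legendre

variable {Ψ : ℝ → ℝ}

theorem le_legendreTransform (hb : ∀ y : ℝ, BddAbove (Set.range fun x : ℝ => x * y - Ψ x))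
    (x y : ℝ) : x * y - Ψ x ≤ legendreTransform Ψ y :=
  le_ciSup (hb y) x

theorem legendreTransform_le {y B : ℝ} (h : ∀ x, x * y - Ψ x ≤ B) : legendreTransform Ψ y ≤ B :=
  ciSup_le h

theorem Function.Even.apply_abs (heven : Function.Even Ψ) (x : ℝ) : Ψ |x| = Ψ x := by
  rcases abs_choice x with h | h <;> rw [h]
  exact heven x

theorem legendreTransform_mono (heven : Function.Even Ψ)
    (hb : ∀ y : ℝ, BddAbove (Set.range fun x : ℝ => x * y - Ψ x)) {s t : ℝ} (hs : 0 ≤ s)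
    (hst : s ≤ t) : legendreTransform Ψ s ≤ legendreTransform Ψ t := by
  refine legendreTransform_le fun x => ?_
  have h1 := le_legendreTransform hb |x| t
  rw [heven.apply_abs] at h1
  have h2 : x * s ≤ |x| * s := mul_le_mul_of_nonneg_right (le_abs_self x) hs
  have h3 : |x| * s ≤ |x| * t := mul_le_mul_of_nonneg_left hst (abs_nonneg x)
  linarith

theorem bddAbove_range_of_rpow_le (heven : Function.Even Ψ) (hconv : ConvexOn ℝ Set.univ Ψ)
    {α a X : ℝ} (hα : 1 < α) (ha : 0 < a) (h : ∀ x, X ≤ x → a * x ^ α ≤ Ψ x) (y : ℝ) :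
    BddAbove (Set.range fun x : ℝ => x * y - Ψ x) := by
  have hev : ∀ᶠ x : ℝ in atTop, |y| / a ≤ x ^ (α - 1) :=
    (tendsto_rpow_atTop (by linarith)).eventually_ge_atTop _
  obtain ⟨R₀, hR₀⟩ := eventually_atTop.1 hev
  set R := max (max R₀ X) 1 with hR
  refine ⟨max (R * |y| - Ψ 0) 0, ?_⟩
  rintro _ ⟨x, rfl⟩
  have hxy : x * y ≤ |x| * |y| := by rw [← abs_mul]; exact le_abs_self _
  rcases le_or_gt |x| R with hx | hx
  · refine le_trans ?_ (le_max_left _ _)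
    have := mul_le_mul_of_nonneg_right hx (abs_nonneg y)
    have := heven.apply_zero_le hconv x
    simp only
    linarith
  · refine le_trans ?_ (le_max_right _ _)
    have h1 : R₀ ≤ |x| := (le_max_left _ _).trans ((le_max_left _ _).trans hx.le)
    have h2 : X ≤ |x| := (le_max_right _ _).trans ((le_max_left _ _).trans hx.le)
    have h3 : 0 < |x| := one_pos.trans_le ((le_max_right _ _).trans hx.le)
    have h4 := h _ h2
    have h5 := (div_le_iff₀ ha).1 (hR₀ _ h1)
    have h6 : |x| ^ α = |x| ^ (α - 1) * |x| := by
      rw [← Real.rpow_add_one h3.ne']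
      congr 1
      ring
    rw [heven.apply_abs, h6] at h4
    have := mul_le_mul_of_nonneg_right h5 h3.le
    simp only
    linarith

/-- The scaling Ψ(ν z) ≥ ν^α Ψ z dualises: for x = ν z, the choice ν l = ν^α gives x l s - Ψ x ≤ ν^α
(z s - Ψ z). The terms X s + |Ψ 0| cover |x| < ν X, where scaling is not available. -/
theorem legendreTransform_mul_le (heven : Function.Even Ψ) (hconv : ConvexOn ℝ Set.univ Ψ)
    (hb : ∀ y : ℝ, BddAbove (Set.range fun x : ℝ => x * y - Ψ x)) {α X : ℝ} (hα : 1 < α)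
    (hX : 0 < X) (hscale : ∀ ν x : ℝ, 1 ≤ ν → X ≤ x → ν ^ α * Ψ x ≤ Ψ (ν * x))
    {l s : ℝ} (hl : 1 ≤ l) (hs : 0 ≤ s) (hs0 : 0 ≤ legendreTransform Ψ s) :
    legendreTransform Ψ (l * s) ≤
      l ^ (α / (α - 1)) * (legendreTransform Ψ s + X * s + |Ψ 0|) := by
  have hα' : 0 < α - 1 := sub_pos.2 hα
  have hl0 : 0 < l := one_pos.trans_le hl
  set ν := l ^ (1 / (α - 1)) with hν
  have hν1 : 1 ≤ ν := Real.one_le_rpow hl (by positivity)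
  have hν0 : 0 < ν := one_pos.trans_le hν1
  have hνα : ν ^ α = l ^ (α / (α - 1)) := by
    rw [hν, ← Real.rpow_mul hl0.le]
    congr 1
    ring
  have hνl : ν * l = ν ^ α := by
    rw [hνα, hν, ← Real.rpow_add_one hl0.ne']
    congr 1
    field_simp
    ring
  rw [← hνα]
  have hνα1 : 1 ≤ ν ^ α := Real.one_le_rpow hν1 (by linarith)
  refine legendreTransform_le fun x => ?_
  have h1 : x * (l * s) ≤ |x| * (l * s) :=
    mul_le_mul_of_nonneg_right (le_abs_self x) (by positivity)
  rcases le_or_gt (ν * X) |x| with hx | hx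
  · set z := |x| / ν with hz
    have hzx : |x| = ν * z := by rw [hz]; field_simp
    have hzX : X ≤ z := by rw [hz, le_div_iff₀ hν0]; linarith
    have h2 := hscale ν z hν1 hzX
    rw [← hzx, heven.apply_abs] at h2
    have h3 : |x| * (l * s) = ν ^ α * (z * s) := by rw [hzx, ← hνl]; ring
    have h4 := mul_le_mul_of_nonneg_left (le_legendreTransform hb z s) (by linarith : 0 ≤ ν ^ α)
    have : 0 ≤ ν ^ α * (X * s + |Ψ 0|) := by positivity
    linarith
  · have h2 : |x| * (l * s) ≤ ν ^ α * (X * s) := by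
      rw [← hνl]
      have := mul_le_mul_of_nonneg_right hx.le (by positivity : 0 ≤ l * s)
      linarith
    have h3 : -Ψ x ≤ ν ^ α * |Ψ 0| := by
      have := heven.apply_zero_le hconv x
      have := neg_abs_le (Ψ 0)
      nlinarith [abs_nonneg (Ψ 0)]
    have : 0 ≤ ν ^ α * legendreTransform Ψ s := by positivity
    linarith

/-- Test the supremum at x = s/(2K), the maximiser for K x²; s ≥ 8K absorbs the additive K. -/
theorem exists_quadratic_le_legendreTransform
    (hb : ∀ y : ℝ, BddAbove (Set.range fun x : ℝ => x * y - Ψ x)) {K : ℝ} (hK : 1 ≤ K)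
    (hquad : ∀ x, Ψ x ≤ K * (x ^ 2 + 1)) {s : ℝ} (hs : 8 * K ≤ s) :
    1 / (8 * K) * s ^ 2 ≤ legendreTransform Ψ s := by
  have hK0 : 0 < K := by linarith
  refine le_trans ?_ (le_legendreTransform hb (s / (2 * K)) s)
  have h1 := hquad (s / (2 * K))
  have h2 : s / (2 * K) * s - K * ((s / (2 * K)) ^ 2 + 1) = 1 / (8 * K) * s ^ 2
      + (s ^ 2 - 8 * K ^ 2) / (8 * K) := by
    field_simp
    ring
  have h3 : 0 ≤ (s ^ 2 - 8 * K ^ 2) / (8 * K) := by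
    refine div_nonneg ?_ (by linarith)
    nlinarith
  linarith

theorem measurable_modifiedCost (heven : Function.Even Ψ)
    (hb : ∀ y : ℝ, BddAbove (Set.range fun x : ℝ => x * y - Ψ x)) (C D : ℝ) :
    Measurable (modifiedCost Ψ C D) := by
  have h1 : Monotone fun t : ℝ => legendreTransform Ψ (max t 0) := fun s t hst =>
    legendreTransform_mono heven hb (le_max_right _ _) (max_le_max hst le_rfl)
  have h2 : Measurable fun t : ℝ => legendreTransform Ψ |t| := by
    have := h1.measurable.comp (measurable_id.abs : Measurable fun t : ℝ => |t|)
    simpa [Function.comp_def] using this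
  unfold modifiedCost
  exact (Measurable.ite (measurableSet_lt measurable_id.abs measurable_const)
    (measurable_id.pow_const 2) h2).const_mul C

theorem modifiedCost_eq_mul (C D t : ℝ) : modifiedCost Ψ C D t = C * modifiedCost Ψ 1 D t := by
  simp [modifiedCost]

/-- These are the only facts about the cost used later: quadratic coercivity, growth of order q =
α/(α - 1), and Young's inequality. Beyond D = 8K the Legendre transform dominates a quadratic, and α
≤ 2 gives q ≥ 2, so the quadratic zone obeys the same power law. -/
theorem exists_modifiedCost_bounds (heven : Function.Even Ψ) (hconv : ConvexOn ℝ Set.univ Ψ)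
    (hb : ∀ y : ℝ, BddAbove (Set.range fun x : ℝ => x * y - Ψ x)) {α X K : ℝ} (hα : 1 < α)
    (hα2 : α ≤ 2) (hX : 0 < X)
    (hscale : ∀ ν x : ℝ, 1 ≤ ν → X ≤ x → ν ^ α * Ψ x ≤ Ψ (ν * x))
    (hK : 1 ≤ K) (hquad : ∀ x, Ψ x ≤ K * (x ^ 2 + 1)) :
    ∃ D c C L : ℝ, 0 < D ∧ 0 < c ∧ 0 < C ∧
      (∀ t, c * t ^ 2 ≤ modifiedCost Ψ 1 D t) ∧
      (∀ l s t : ℝ, 1 ≤ l → |s| ≤ l * |t| →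
        modifiedCost Ψ 1 D s ≤ C * l ^ (α / (α - 1)) * modifiedCost Ψ 1 D t) ∧
      (∀ x t : ℝ, 2 * |x| * |t| ≤ Ψ x + L + C * modifiedCost Ψ 1 D t) := by
  have hα' : 0 < α - 1 := sub_pos.2 hα
  set q := α / (α - 1) with hq
  have hq2 : 2 ≤ q := by rw [hq, le_div_iff₀ hα']; linarith
  set D := 8 * K with hD
  have hD1 : 1 ≤ D := by linarith
  have hD0 : 0 < D := by linarith
  set c := 1 / (8 * K) with hc
  have hc0 : 0 < c := by positivity
  have hc1 : c ≤ 1 := by rw [hc, div_le_one (by linarith)]; linarith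
  set leg := legendreTransform Ψ with hleg
  have hquadleg : ∀ s, D ≤ s → c * s ^ 2 ≤ leg s := fun s hs =>
    exists_quadratic_le_legendreTransform hb hK hquad hs
  have hlegnn : ∀ s, D ≤ s → 0 ≤ leg s := fun s hs =>
    le_trans (by positivity) (hquadleg s hs)
  have hGlow : ∀ t, c * t ^ 2 ≤ modifiedCost Ψ 1 D t := by
    intro t
    rw [modifiedCost, one_mul]
    split_ifs with h
    · nlinarith [sq_nonneg t]
    · rw [← sq_abs]
      exact hquadleg _ (not_lt.1 h)
  set C₁ := 1 + (X + |Ψ 0|) / c with hC₁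
  have hC₁0 : 0 < C₁ := by positivity
  have hmul : ∀ l s : ℝ, 1 ≤ l → D ≤ s → leg (l * s) ≤ l ^ q * (C₁ * leg s) := by
    intro l s hl hs
    have hs0 : 0 ≤ s := by linarith
    have hs1 : 1 ≤ s := by linarith
    refine (legendreTransform_mul_le heven hconv hb hα hX hscale hl hs0 (hlegnn s hs)).trans ?_
    have hl0 : 0 ≤ l ^ q := by positivity
    refine mul_le_mul_of_nonneg_left ?_ hl0
    have h1 : X * s + |Ψ 0| ≤ (X + |Ψ 0|) * s ^ 2 := by
      have := abs_nonneg (Ψ 0)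
      have h1 : s ≤ s ^ 2 := by nlinarith
      have h2 : 1 ≤ s ^ 2 := by nlinarith
      nlinarith
    have h2 : (X + |Ψ 0|) * s ^ 2 ≤ (X + |Ψ 0|) / c * leg s := by
      rw [div_mul_eq_mul_div, le_div_iff₀ hc0, mul_assoc, mul_comm (s ^ 2)]
      exact mul_le_mul_of_nonneg_left (hquadleg s hs) (by positivity)
    rw [hC₁, add_mul, one_mul]
    linarith
  set C₂ := 1 / c + C₁ + C₁ * leg D / D ^ 2 with hC₂
  have hlegD := hlegnn D le_rfl
  have p1 : 0 ≤ 1 / c := by positivity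
  have p2 : 0 ≤ C₁ * leg D / D ^ 2 := by positivity
  have hC₂0 : 0 < C₂ := by positivity
  have hG2 : ∀ l s t : ℝ, 1 ≤ l → |s| ≤ l * |t| →
      modifiedCost Ψ 1 D s ≤ C₂ * l ^ q * modifiedCost Ψ 1 D t := by
    intro l s t hl hst
    have hl0 : 0 < l := by linarith
    have hGt : 0 ≤ modifiedCost Ψ 1 D t := le_trans (by positivity) (hGlow t)
    have hlq : 0 < l ^ q := by positivity
    have hlG : 0 ≤ l ^ q * modifiedCost Ψ 1 D t := by positivity
    have mono : ∀ C, C ≤ C₂ → C * (l ^ q * modifiedCost Ψ 1 D t)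
        ≤ C₂ * l ^ q * modifiedCost Ψ 1 D t := fun C hC => by
      rw [mul_assoc]
      exact mul_le_mul_of_nonneg_right hC hlG
    rcases lt_or_ge |s| D with hs | hs
    · refine le_trans ?_ (mono (1 / c) (by linarith))
      have e : modifiedCost Ψ 1 D s = s ^ 2 := by simp [modifiedCost, hs]
      rw [e, div_mul_eq_mul_div, le_div_iff₀ hc0, one_mul]
      have h1 : s ^ 2 ≤ l ^ 2 * t ^ 2 := by
        rw [← sq_abs s, ← sq_abs t, ← mul_pow]
        exact pow_le_pow_left₀ (abs_nonneg _) hst 2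
      have h2 : l ^ 2 ≤ l ^ q := by
        rw [← Real.rpow_two]
        exact Real.rpow_le_rpow_of_exponent_le hl hq2
      calc s ^ 2 * c ≤ l ^ 2 * t ^ 2 * c := mul_le_mul_of_nonneg_right h1 hc0.le
        _ = l ^ 2 * (c * t ^ 2) := by ring
        _ ≤ l ^ q * modifiedCost Ψ 1 D t :=
          mul_le_mul h2 (hGlow t) (by positivity) hlq.le
    · have e : modifiedCost Ψ 1 D s = leg |s| := by simp [modifiedCost, not_lt.2 hs, hleg]
      rw [e]
      have h1 : leg |s| ≤ leg (l * |t|) := legendreTransform_mono heven hb (abs_nonneg s) hst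
      refine h1.trans ?_
      rcases lt_or_ge |t| D with ht | ht
      · refine le_trans ?_ (mono (C₁ * leg D / D ^ 2) (by linarith))
        have et : modifiedCost Ψ 1 D t = |t| ^ 2 := by simp [modifiedCost, ht]
        -- Scaling starts from D because |t| lies in the quadratic zone; since |t|/D < 1 and q ≥ 2,
        -- (|t|/D)^q is at most (|t|/D)².
        have h2 := hmul (l * |t| / D) D ((one_le_div hD0).2 (hs.trans hst)) le_rfl
        rw [div_mul_cancel₀ _ hD0.ne'] at h2
        refine h2.trans ?_
        rw [mul_div_assoc, Real.mul_rpow hl0.le (by positivity), et]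
        have h3 : (|t| / D) ^ q ≤ (|t| / D) ^ 2 := by
          rw [← Real.rpow_two]
          have ht0 : 0 < |t| := by
            by_contra! hc
            have : |t| = 0 := le_antisymm hc (abs_nonneg _)
            rw [this] at hst
            linarith
          exact Real.rpow_le_rpow_of_exponent_ge (by positivity) ((div_le_one hD0).2 ht.le) hq2
        calc l ^ q * (|t| / D) ^ q * (C₁ * leg D) ≤ l ^ q * (|t| / D) ^ 2 * (C₁ * leg D) := by
              gcongr
          _ = _ := by rw [div_pow]; ring
      · refine le_trans ?_ (mono C₁ (by linarith))
        have et : modifiedCost Ψ 1 D t = leg |t| := by simp [modifiedCost, not_lt.2 ht, hleg]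
        rw [et]
        exact (hmul l |t| hl ht).trans (le_of_eq (by ring))
  -- The factor 2^q lets one constant also serve the doubling t ↦ 2t in Young's inequality; `leg D`
  -- covers arguments below the threshold.
  refine ⟨D, c, C₂ * 2 ^ q, leg D, hD0, hc0, by positivity, hGlow, fun l s t hl hst => ?_,
    fun x t => ?_⟩
  · refine (hG2 l s t hl hst).trans ?_
    have hGt : 0 ≤ modifiedCost Ψ 1 D t := le_trans (by positivity) (hGlow t)
    have : (1 : ℝ) ≤ 2 ^ q := Real.one_le_rpow one_le_two (by linarith)
    have hlq : 0 ≤ l ^ q := by positivity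
    gcongr
    exact le_mul_of_one_le_right hC₂0.le this
  · have h1 := le_legendreTransform hb |x| (2 * |t|)
    rw [heven.apply_abs] at h1
    have h2 := hG2 2 (2 * t) t one_le_two (by rw [abs_mul]; simp)
    have h3 : legendreTransform Ψ (2 * |t|) ≤ modifiedCost Ψ 1 D (2 * t) + leg D := by
      have e : |2 * t| = 2 * |t| := by rw [abs_mul]; simp
      rw [modifiedCost, one_mul, e]
      split_ifs with h
      · have := legendreTransform_mono heven hb (by positivity) h.le
        have := sq_nonneg (2 * t)
        linarith
      · linarith
    linarith

/-- Beyond X, differentiate the monotone quotient Ψ/x^α. On [-X, X] the left side is nonpositive and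
the right side nonnegative. Parity gives negative x. -/
theorem euler_inequality (heven : Function.Even Ψ) (hconv : ConvexOn ℝ Set.univ Ψ)
    {α X : ℝ} (hα : 0 < α) (hX : 0 < X) (hΨX : 0 ≤ Ψ X)
    (hmono : MonotoneOn (fun x => Ψ x / x ^ α) (Set.Ici X)) :
    ∀ᵐ x : ℝ, α * (Ψ x - Ψ X) ≤ x * deriv Ψ x := by
  have pos : ∀ x : ℝ, X < x → DifferentiableAt ℝ Ψ x → α * Ψ x ≤ x * deriv Ψ x := by
    intro x hx hd
    have hx0 : 0 < x := hX.trans hx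
    have h1 := hmono.derivWithin_nonneg (x := x)
    rw [derivWithin_of_mem_nhds (Ici_mem_nhds hx)] at h1
    have hp : 0 < x ^ α := Real.rpow_pos_of_pos hx0 α
    have h2 := (hd.hasDerivAt.div (Real.hasDerivAt_rpow_const (p := α) (Or.inl hx0.ne'))
      hp.ne').deriv
    rw [show deriv (fun x => Ψ x / x ^ α) x = _ from h2] at h1
    have h3 : 0 ≤ deriv Ψ x * x ^ α - Ψ x * (α * x ^ (α - 1)) := by
      by_contra! hc
      exact absurd h1 (not_le.2 (div_neg_of_neg_of_pos hc (by positivity)))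
    have h4 : x ^ α = x ^ (α - 1) * x := by
      rw [← Real.rpow_add_one hx0.ne']
      congr 1
      ring
    rw [h4] at h3
    have hp' : 0 < x ^ (α - 1) := Real.rpow_pos_of_pos hx0 _
    have h5 : 0 ≤ x ^ (α - 1) * (x * deriv Ψ x - α * Ψ x) := by linarith
    linarith [nonneg_of_mul_nonneg_right h5 hp']
  filter_upwards [hconv.locallyLipschitz.ae_differentiableAt_real] with x hd
  have hαX : 0 ≤ α * Ψ X := by positivity
  rcases le_or_gt |x| X with hx | hx
  · have h1 := hconv.add_deriv_mul_sub_le hd 0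
    have h2 := heven.apply_zero_le hconv x
    have h3 : Ψ x ≤ Ψ X := heven.le_of_abs_le_abs hconv (by rwa [abs_of_pos hX])
    have h4 := mul_nonneg hα.le (sub_nonneg.2 h3)
    linarith
  · rcases lt_abs.1 hx with h | h
    · linarith [pos x h hd]
    · have e : (fun y => Ψ (-y)) = Ψ := funext heven
      have hd' : DifferentiableAt ℝ Ψ (-x) := by
        have : DifferentiableAt ℝ (fun y => Ψ (-y)) (-x) :=
          DifferentiableAt.comp (-x) (by simpa using hd) differentiableAt_id.neg
        rwa [e] at this
      have h1 := pos (-x) h hd'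
      have h2 := deriv_comp_neg Ψ x
      rw [e] at h2
      rw [heven x] at h1
      have h3 : deriv Ψ (-x) = -deriv Ψ x := by linarith
      rw [h3] at h1
      linarith

end Legendre

/-! ### Truncation at high levels. -/

/-- The function `f · min((f - 1)₊, 1)^p`: it vanishes where `f ≤ 1` and equals `f` where
`f ≥ 2`. -/
noncomputable def upperTruncation (p : ℝ) (f : ℝ → ℝ) (x : ℝ) : ℝ :=
  f x * (max 0 (min (f x - 1) 1)) ^ p

section Truncation

variable {f : ℝ → ℝ} {p : ℝ}

theorem locallyLipschitz_upperTruncation (hf : LocallyLipschitz f) (hp : 1 ≤ p) :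
    LocallyLipschitz (upperTruncation p f) := by
  have h1 : LocallyLipschitz (fun x => f x - 1) := by
    simpa [sub_eq_add_neg] using hf.add (LocallyLipschitz.const (-1))
  exact hf.mul_real (((h1.min_const 1).const_max 0).rpow_const_real hp)

theorem upperTruncation_of_le_one (hp : 1 ≤ p) {x : ℝ} (hx : f x ≤ 1) :
    upperTruncation p f x = 0 := by
  have : max 0 (min (f x - 1) 1) = 0 :=
    max_eq_left ((min_le_left _ _).trans (by linarith))
  rw [upperTruncation, this, Real.zero_rpow (by linarith), mul_zero]

theorem upperTruncation_of_mem {x : ℝ} (h1 : 1 ≤ f x) (h2 : f x ≤ 2) :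
    upperTruncation p f x = f x * (f x - 1) ^ p := by
  rw [upperTruncation, min_eq_left (by linarith), max_eq_right (by linarith)]

theorem upperTruncation_of_two_le {x : ℝ} (hx : 2 ≤ f x) : upperTruncation p f x = f x := by
  rw [upperTruncation, min_eq_right (by linarith), max_eq_right zero_le_one, Real.one_rpow, mul_one]

theorem upperTruncation_sq_le (hp : 1 ≤ p) {x : ℝ} (hx : 0 ≤ f x) :
    upperTruncation p f x ^ 2 ≤ f x ^ 2 ∧ upperTruncation p f x ^ 2 ≤ 4 * (f x - 1) ^ 2 := by
  rcases le_or_gt (f x) 1 with h1 | h1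
  · rw [upperTruncation_of_le_one hp h1]
    constructor <;> nlinarith [sq_nonneg (f x), sq_nonneg (f x - 1)]
  rcases le_or_gt (f x) 2 with h2 | h2
  · rw [upperTruncation_of_mem h1.le h2]
    have hk0 : 0 < f x - 1 := by linarith
    have hk1 : f x - 1 ≤ 1 := by linarith
    have e0 : 0 ≤ (f x - 1) ^ p := by positivity
    have e1 : (f x - 1) ^ p ≤ f x - 1 := by
      simpa using Real.rpow_le_rpow_of_exponent_ge hk0 hk1 hp
    constructor
    · refine pow_le_pow_left₀ (by positivity) ?_ 2
      nlinarith
    · rw [show 4 * (f x - 1) ^ 2 = (2 * (f x - 1)) ^ 2 by ring]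
      refine pow_le_pow_left₀ (by positivity) ?_ 2
      exact mul_le_mul h2 e1 e0 zero_le_two
  · rw [upperTruncation_of_two_le h2.le]
    exact ⟨le_rfl, by nlinarith⟩

/-- Truncation does not increase the energy by more than a constant factor, provided the exponent
is half the growth exponent of the cost. -/
theorem ae_cost_upperTruncation_le {G : ℝ → ℝ} {C : ℝ} (hp : 1 ≤ p) (hf : LocallyLipschitz f)
    (hG : ∀ t, 0 ≤ G t) (hC : 0 ≤ C)
    (hG2 : ∀ l s t : ℝ, 1 ≤ l → |s| ≤ l * |t| → G s ≤ C * l ^ (2 * p) * G t) :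
    ∀ᵐ x : ℝ, G (deriv (upperTruncation p f) x / upperTruncation p f x)
        * upperTruncation p f x ^ 2
      ≤ C * (1 + 2 * p) ^ (2 * p) * (G (deriv f x / f x) * f x ^ 2) := by
  filter_upwards [hf.ae_differentiableAt_real,
    ae_deriv_eq_zero_of_eq (upperTruncation p f) 2] with x hd hz
  set g := upperTruncation p f with hg
  have hl : (1 : ℝ) ≤ 1 + 2 * p := by linarith
  have big : 2 ≤ f x → |deriv g x / g x| ≤ (1 + 2 * p) * |deriv f x / f x| →
      G (deriv g x / g x) * g x ^ 2
        ≤ C * (1 + 2 * p) ^ (2 * p) * (G (deriv f x / f x) * f x ^ 2) := by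
    intro h2 hle
    have hgf : g x = f x := upperTruncation_of_two_le h2
    rw [← mul_assoc, show g x ^ 2 = f x ^ 2 by rw [hgf]]
    exact mul_le_mul_of_nonneg_right (hG2 _ _ _ hl hle) (sq_nonneg _)
  rcases le_or_gt (f x) 1 with h1 | h1
  · rw [show g x = 0 from upperTruncation_of_le_one hp h1]
    have := hG (deriv f x / f x)
    simp only [ne_eq, OfNat.ofNat_ne_zero, not_false_eq_true, zero_pow, mul_zero]
    positivity
  rcases lt_trichotomy (f x) 2 with h2 | h2 | h2
  · have hev : g =ᶠ[nhds x] fun y => f y * (f y - 1) ^ p := by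
      filter_upwards [hf.continuous.continuousAt.eventually (lt_mem_nhds h1),
        hf.continuous.continuousAt.eventually (gt_mem_nhds h2)] with y hy1 hy2
      exact upperTruncation_of_mem hy1.le hy2.le
    have hk0 : 0 < f x - 1 := by linarith
    have hf0 : 0 < f x := by linarith
    have hder := (hd.hasDerivAt.mul ((hd.hasDerivAt.sub_const 1).rpow_const (p := p)
      (Or.inl hk0.ne'))).deriv
    have hgx : g x = f x * (f x - 1) ^ p := hev.self_of_nhds
    have hgd : deriv g x = deriv f x * (f x - 1) ^ p
        + f x * (deriv f x * p * (f x - 1) ^ (p - 1)) := by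
      rw [hev.deriv_eq]
      exact hder
    set k := f x - 1 with hk
    have hkp : k ^ p = k ^ (p - 1) * k := by
      rw [← Real.rpow_add_one hk0.ne']
      congr 1
      ring
    have hkp0 : 0 < k ^ (p - 1) := Real.rpow_pos_of_pos hk0 _
    have hratio : deriv g x / g x = (1 + p * f x / k) * (deriv f x / f x) := by
      rw [hgd, hgx, hkp]
      field_simp
    -- The logarithmic derivative blows up like 1/k as f decreases to 1; the cost pays at most
    -- k^{-2p}, which cancels exactly against the factor k^{2p} in g².
    have hlk : 1 + p * f x / k ≤ (1 + 2 * p) / k := by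
      rw [le_div_iff₀ hk0, add_mul, div_mul_cancel₀ _ hk0.ne']
      nlinarith
    have hl1 : 1 ≤ (1 + 2 * p) / k := by
      rw [le_div_iff₀ hk0]
      linarith
    have hpos : 0 ≤ 1 + p * f x / k := by positivity
    have h3 := hG2 _ (deriv g x / g x) (deriv f x / f x) hl1 (by
      rw [hratio, abs_mul, abs_of_nonneg hpos]
      exact mul_le_mul_of_nonneg_right hlk (abs_nonneg _))
    have h4 := mul_le_mul_of_nonneg_right h3 (sq_nonneg (g x))
    refine h4.trans (le_of_eq ?_)
    have h5 : (k ^ p) ^ 2 = k ^ (2 * p) := by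
      rw [← Real.rpow_natCast, ← Real.rpow_mul hk0.le]
      congr 1
      push_cast
      ring
    have h6 : k ^ (2 * p) ≠ 0 := (Real.rpow_pos_of_pos hk0 _).ne'
    rw [hgx, mul_pow, h5, Real.div_rpow (by linarith) hk0.le]
    field_simp
  -- At f = 2 the truncation may have a kink, but g = 2 there and g' vanishes almost everywhere on
  -- that level set.
  · have hgf : g x = 2 := (upperTruncation_of_two_le h2.ge).trans h2
    refine big h2.ge ?_
    rw [hz hgf]
    simp only [zero_div, abs_zero]
    positivity
  · have hev : g =ᶠ[nhds x] f := by
      filter_upwards [hf.continuous.continuousAt.eventually (lt_mem_nhds h2)] with y hy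
      exact upperTruncation_of_two_le hy.le
    refine big h2.le ?_
    rw [hev.deriv_eq, hev.self_of_nhds]
    exact le_mul_of_one_le_left (abs_nonneg _) hl

end Truncation

/-! ### Entropy bound for normalized functions. -/

/-- On {f = 0} the right side is 0, which is harmless because f' = 0 almost everywhere there. -/
theorem ae_deriv_sq_le_cost {G f : ℝ → ℝ} {c : ℝ} (hGlow : ∀ t, c * t ^ 2 ≤ G t) :
    ∀ᵐ x : ℝ, c * deriv f x ^ 2 ≤ G (deriv f x / f x) * f x ^ 2 := by
  filter_upwards [ae_deriv_eq_zero_of_eq f 0] with x hx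
  rcases eq_or_ne (f x) 0 with h | h
  · simp [h, hx h]
  · have := mul_le_mul_of_nonneg_right (hGlow (deriv f x / f x)) (sq_nonneg (f x))
    refine le_trans (le_of_eq ?_) this
    field_simp

theorem integrable_deriv_sq_of_cost {Ψ G f : ℝ → ℝ} {c : ℝ} (hc : 0 < c)
    (hGlow : ∀ t, c * t ^ 2 ≤ G t) (hΨ : Continuous Ψ)
    (hi : Integrable (fun x => G (deriv f x / f x) * f x ^ 2 * Real.exp (-Ψ x))) :
    Integrable (fun x => deriv f x ^ 2 * Real.exp (-Ψ x)) ∧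
    ∫ x, deriv f x ^ 2 * Real.exp (-Ψ x) ≤
      1 / c * ∫ x, G (deriv f x / f x) * f x ^ 2 * Real.exp (-Ψ x) := by
  have hae : ∀ᵐ x : ℝ, deriv f x ^ 2 * Real.exp (-Ψ x) ≤
      1 / c * (G (deriv f x / f x) * f x ^ 2 * Real.exp (-Ψ x)) := by
    filter_upwards [ae_deriv_sq_le_cost (f := f) hGlow] with x hx
    rw [one_div_mul_eq_div, le_div_iff₀ hc]
    have := mul_le_mul_of_nonneg_right hx (Real.exp_pos (-Ψ x)).le
    linarith
  have hint : Integrable (fun x => deriv f x ^ 2 * Real.exp (-Ψ x)) := by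
    refine (hi.const_mul (1 / c)).mono'
      (((measurable_deriv f).pow_const 2).mul (by fun_prop)).aestronglyMeasurable ?_
    filter_upwards [hae] with x hx
    rwa [Real.norm_of_nonneg (by positivity)]
  refine ⟨hint, ?_⟩
  rw [← integral_const_mul]
  exact integral_mono_ae hint (hi.const_mul _) hae

/-- From log s ≤ s - 1, since the right side is exactly 2 s² (s - 1). The part s² - 1 integrates to
zero after normalization. -/
theorem sq_mul_log_sq_le {s : ℝ} (hs : 0 ≤ s) :
    s ^ 2 * Real.log (s ^ 2) ≤ (s ^ 2 - 1) + (s - 1) ^ 2 * (2 * s + 1) := by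
  rcases hs.eq_or_lt with rfl | h
  · simp
  · rw [Real.log_pow]
    have := Real.log_le_sub_one_of_pos h
    have h2 := mul_le_mul_of_nonneg_left this (by positivity : 0 ≤ 2 * s ^ 2)
    push_cast
    nlinarith

theorem neg_one_le_mul_log {s : ℝ} (hs : 0 ≤ s) : -1 ≤ s * Real.log s := by
  rcases hs.eq_or_lt with rfl | h
  · simp
  · have := mul_le_mul_of_nonneg_left (Real.one_sub_inv_le_log_of_pos h) hs
    rw [mul_sub, mul_inv_cancel₀ h.ne'] at this
    linarith

/-- For a unit vector of `L²`, the distance to `1` is controlled by the variance. -/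
theorem integral_sub_one_sq_le {w f : ℝ → ℝ} (hw : ∀ x, 0 ≤ w x) (hwc : Continuous w)
    (hfc : Continuous f) (hf : ∀ x, 0 ≤ f x) (hint : Integrable w) (hone : ∫ x, w x = 1)
    (hi : Integrable (fun x => f x ^ 2 * w x)) (h1 : ∫ x, f x ^ 2 * w x = 1) (a : ℝ) :
    Integrable (fun x => (f x - 1) ^ 2 * w x) ∧
    ∫ x, (f x - 1) ^ 2 * w x ≤ 2 * ∫ x, (f x - a) ^ 2 * w x := by
  have hfw : Integrable (fun x => f x * w x) := by
    refine (hi.add hint).mono' (hfc.mul hwc).aestronglyMeasurable (Eventually.of_forall fun x => ?_)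
    rw [Real.norm_of_nonneg (mul_nonneg (hf x) (hw x))]
    have : f x ≤ f x ^ 2 + 1 := by nlinarith [sq_nonneg (f x - 1), hf x]
    have := mul_le_mul_of_nonneg_right this (hw x)
    simp only [Pi.add_apply]
    linarith
  set F := ∫ x, f x * w x with hF
  have expand : ∀ b : ℝ, Integrable (fun x => (f x - b) ^ 2 * w x) ∧
      ∫ x, (f x - b) ^ 2 * w x = 1 - 2 * b * F + b ^ 2 := by
    intro b
    have e : (fun x => (f x - b) ^ 2 * w x)
        = fun x => f x ^ 2 * w x - 2 * b * (f x * w x) + b ^ 2 * w x := by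
      funext x
      ring
    have hsub : Integrable (fun x => f x ^ 2 * w x - 2 * b * (f x * w x)) :=
      hi.sub (hfw.const_mul _)
    rw [e]
    refine ⟨hsub.add (hint.const_mul _), ?_⟩
    rw [integral_add hsub (hint.const_mul _),
      integral_sub hi (hfw.const_mul _), integral_const_mul, integral_const_mul, h1, hone, mul_one]
  refine ⟨(expand 1).1, ?_⟩
  have hF0 : 0 ≤ F := integral_nonneg fun x => mul_nonneg (hf x) (hw x)
  have hv : 0 ≤ ∫ x, (f x - F) ^ 2 * w x :=
    integral_nonneg fun x => mul_nonneg (sq_nonneg _) (hw x)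
  rw [(expand F).2] at hv
  rw [(expand 1).2, (expand a).2]
  -- As 0 ≤ F ≤ 1, ∫ (f - 1)² = 2(1 - F) ≤ 2(1 - F²), twice the variance, which is minimal among the
  -- ∫ (f - a)².
  have hF1 : F ≤ 1 := by nlinarith
  nlinarith [sq_nonneg (F - a)]

/-- The entropy bound for non-negative functions of unit `L²` norm. -/
theorem exists_entropy_bound_of_normalized {Ψ G : ℝ → ℝ} (heven : Function.Even Ψ)
    (hconv : ConvexOn ℝ Set.univ Ψ) (hint : Integrable (fun x => Real.exp (-Ψ x)))
    (hone : ∫ x, Real.exp (-Ψ x) = 1) {α M c C L p : ℝ} (hα : 1 < α) (hc : 0 < c) (hC : 0 < C)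
    (hp : 1 ≤ p) (hGm : Measurable G) (hGlow : ∀ t, c * t ^ 2 ≤ G t)
    (hG2 : ∀ l s t : ℝ, 1 ≤ l → |s| ≤ l * |t| → G s ≤ C * l ^ (2 * p) * G t)
    (heuler : ∀ᵐ x : ℝ, α * (Ψ x - M) ≤ x * deriv Ψ x)
    (hyoung : ∀ x t : ℝ, 2 * |x| * |t| ≤ Ψ x + L + C * G t) :
    ∃ A : ℝ, 0 < A ∧ ∀ f : ℝ → ℝ, LocallyLipschitz f → (∀ x, 0 ≤ f x) →
      Integrable (fun x => f x ^ 2 * Real.exp (-Ψ x)) →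
      ∫ x, f x ^ 2 * Real.exp (-Ψ x) = 1 →
      Integrable (fun x => G (deriv f x / f x) * f x ^ 2 * Real.exp (-Ψ x)) →
      Integrable (fun x => f x ^ 2 * Real.log (f x ^ 2) * Real.exp (-Ψ x)) ∧
      ∫ x, f x ^ 2 * Real.log (f x ^ 2) * Real.exp (-Ψ x) ≤
        A * ∫ x, G (deriv f x / f x) * f x ^ 2 * Real.exp (-Ψ x) := by
  have hG : ∀ t, 0 ≤ G t := fun t => le_trans (by positivity) (hGlow t)
  have hΨ := hconv.locallyLipschitz
  have hΨc : Continuous Ψ := hΨ.continuous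
  obtain ⟨P, hP, poincare⟩ := exists_poincare_const heven hconv hint hone
  obtain ⟨B, hB, supBound⟩ := exists_sup_bound heven hconv
  obtain ⟨Q, hQ, moment⟩ := exists_potential_moment_bound heven hconv hG hα hC.le heuler hyoung
  set T := C * (1 + 2 * p) ^ (2 * p) with hT
  have hT0 : 0 < T := by positivity
  set S₀ := 2 * (P * (1 / c)) with hS₀
  have hS₀0 : 0 < S₀ := by positivity
  refine ⟨5 * S₀ + B * (4 * S₀ + 1 / c * T) + |Ψ 0| * (4 * S₀) + Q * (4 * S₀ + T),
    by positivity, fun f hf hf0 hi h1 hiG => ?_⟩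
  set E := ∫ x, G (deriv f x / f x) * f x ^ 2 * Real.exp (-Ψ x) with hE
  have hE0 : 0 ≤ E := integral_nonneg fun x =>
    mul_nonneg (mul_nonneg (hG _) (sq_nonneg _)) (Real.exp_pos _).le
  obtain ⟨hd, hdE⟩ := integrable_deriv_sq_of_cost hc hGlow hΨc hiG
  obtain ⟨-, hPf⟩ := poincare f hf hd
  obtain ⟨hiS, hS⟩ := integral_sub_one_sq_le (w := fun x => Real.exp (-Ψ x))
    (fun x => (Real.exp_pos _).le) (by fun_prop) hf.continuous hf0 hint hone hi h1 (f 0)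
  set S := ∫ x, (f x - 1) ^ 2 * Real.exp (-Ψ x) with hSdef
  have hSE : S ≤ S₀ * E := by
    have := mul_le_mul_of_nonneg_left hdE hP.le
    rw [hS₀]
    linarith
  set g := upperTruncation p f with hg
  have hgl : LocallyLipschitz g := locallyLipschitz_upperTruncation hf hp
  have hgc := hgl.continuous
  have hfc := hf.continuous
  have hgi : Integrable (fun x => g x ^ 2 * Real.exp (-Ψ x)) := by
    refine hi.mono' (by fun_prop) (Eventually.of_forall fun x => ?_)
    rw [Real.norm_of_nonneg (by positivity)]
    exact mul_le_mul_of_nonneg_right (upperTruncation_sq_le hp (hf0 x)).1 (Real.exp_pos _).le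
  set m := ∫ x, g x ^ 2 * Real.exp (-Ψ x) with hm
  have hm0 : 0 ≤ m := integral_nonneg fun x => by positivity
  have hm1 : m ≤ 1 := by
    rw [← h1]
    exact integral_mono hgi hi fun x =>
      mul_le_mul_of_nonneg_right (upperTruncation_sq_le hp (hf0 x)).1 (Real.exp_pos _).le
  have hmS : m ≤ 4 * S := by
    rw [hSdef, ← integral_const_mul]
    refine integral_mono hgi (hiS.const_mul _) fun x => ?_
    have := mul_le_mul_of_nonneg_right (upperTruncation_sq_le hp (hf0 x)).2
      (Real.exp_pos (-Ψ x)).le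
    simp only
    linarith
  have hgcost : ∀ᵐ x : ℝ, G (deriv g x / g x) * g x ^ 2 * Real.exp (-Ψ x)
      ≤ T * (G (deriv f x / f x) * f x ^ 2 * Real.exp (-Ψ x)) := by
    filter_upwards [ae_cost_upperTruncation_le hp hf hG hC.le hG2] with x hx
    have := mul_le_mul_of_nonneg_right hx (Real.exp_pos (-Ψ x)).le
    linarith
  have hnn : ∀ x, 0 ≤ G (deriv g x / g x) * g x ^ 2 * Real.exp (-Ψ x) := fun x =>
    mul_nonneg (mul_nonneg (hG _) (sq_nonneg _)) (Real.exp_pos _).le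
  have hgiG : Integrable (fun x => G (deriv g x / g x) * g x ^ 2 * Real.exp (-Ψ x)) := by
    refine (hiG.const_mul T).mono' ?_ ?_
    · exact (((hGm.comp ((measurable_deriv g).div hgc.measurable)).mul
        (hgc.measurable.pow_const 2)).mul
        (Real.continuous_exp.comp hΨc.neg).measurable).aestronglyMeasurable
    · filter_upwards [hgcost] with x hx
      rwa [Real.norm_of_nonneg (hnn x)]
  set e := ∫ x, G (deriv g x / g x) * g x ^ 2 * Real.exp (-Ψ x) with he
  have heE : e ≤ T * E := by
    rw [hE, ← integral_const_mul]
    exact integral_mono_ae hgiG (hiG.const_mul T) hgcost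
  obtain ⟨hgd, hgdE⟩ := integrable_deriv_sq_of_cost hc hGlow hΨc hgiG
  have hsup := supBound g hgl hgi hgd
  obtain ⟨hiM, hM⟩ := moment g hgl hgi hgiG
  set V := B * (m + ∫ x, deriv g x ^ 2 * Real.exp (-Ψ x)) with hV
  have hd0 : 0 ≤ ∫ x, deriv g x ^ 2 * Real.exp (-Ψ x) := integral_nonneg fun x => by positivity
  have hV0 : 0 ≤ V := by positivity
  -- For f ≤ 2 the first two terms suffice; for f > 2, g = f and log f² ≤ V + Ψ.
  have pointwise : ∀ x, f x ^ 2 * Real.log (f x ^ 2) ≤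
      (f x ^ 2 - 1) + 5 * (f x - 1) ^ 2 + (V + |Ψ 0|) * g x ^ 2 + (Ψ x - Ψ 0) * g x ^ 2 := by
    intro x
    have hmin := sub_nonneg.2 (heven.apply_zero_le hconv x)
    have n1 : 0 ≤ (V + |Ψ 0|) * g x ^ 2 := by positivity
    have n2 : 0 ≤ (Ψ x - Ψ 0) * g x ^ 2 := by positivity
    rcases le_or_gt (f x) 2 with h2 | h2
    · have h3 := sq_mul_log_sq_le (hf0 x)
      have h4 : (f x - 1) ^ 2 * (2 * f x + 1) ≤ (f x - 1) ^ 2 * 5 :=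
        mul_le_mul_of_nonneg_left (by linarith) (sq_nonneg _)
      linarith
    · have hgf : g x = f x := upperTruncation_of_two_le h2.le
      have hv := hsup x
      rw [hgf] at hv ⊢
      have hfp : 0 < f x ^ 2 := by positivity
      have h3 : Real.log (f x ^ 2) = Real.log (f x ^ 2 * Real.exp (-Ψ x)) + Ψ x := by
        rw [Real.log_mul hfp.ne' (Real.exp_pos _).ne', Real.log_exp]
        ring
      have h4 : Real.log (f x ^ 2 * Real.exp (-Ψ x)) ≤ V :=
        ((Real.log_le_sub_one_of_pos (by positivity)).trans (by linarith)).trans hv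
      have h5 : Real.log (f x ^ 2) ≤ (V + |Ψ 0|) + (Ψ x - Ψ 0) := by
        rw [h3]
        linarith [le_abs_self (Ψ 0)]
      have h6 := mul_le_mul_of_nonneg_left h5 hfp.le
      nlinarith [sq_nonneg (f x - 1)]
  set U : ℝ → ℝ := fun x => (f x ^ 2 * Real.exp (-Ψ x) - Real.exp (-Ψ x))
    + 5 * ((f x - 1) ^ 2 * Real.exp (-Ψ x)) + (V + |Ψ 0|) * (g x ^ 2 * Real.exp (-Ψ x))
    + (Ψ x - Ψ 0) * g x ^ 2 * Real.exp (-Ψ x) with hU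
  have i1 : Integrable (fun x => f x ^ 2 * Real.exp (-Ψ x) - Real.exp (-Ψ x)) := hi.sub hint
  have i2 : Integrable (fun x => (f x ^ 2 * Real.exp (-Ψ x) - Real.exp (-Ψ x))
    + 5 * ((f x - 1) ^ 2 * Real.exp (-Ψ x))) := i1.add (hiS.const_mul 5)
  have i3 : Integrable (fun x => (f x ^ 2 * Real.exp (-Ψ x) - Real.exp (-Ψ x))
    + 5 * ((f x - 1) ^ 2 * Real.exp (-Ψ x)) + (V + |Ψ 0|) * (g x ^ 2 * Real.exp (-Ψ x))) :=
    i2.add (hgi.const_mul _)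
  have hUi : Integrable U := i3.add hiM
  have hUval : ∫ x, U x = 5 * S + (V + |Ψ 0|) * m
      + ∫ x, (Ψ x - Ψ 0) * g x ^ 2 * Real.exp (-Ψ x) := by
    rw [hU, integral_add i3 hiM, integral_add i2 (hgi.const_mul _),
      integral_add i1 (hiS.const_mul 5), integral_sub hi hint, integral_const_mul,
      integral_const_mul, h1, hone]
    ring
  have hle : ∀ x, f x ^ 2 * Real.log (f x ^ 2) * Real.exp (-Ψ x) ≤ U x := fun x => by
    have := mul_le_mul_of_nonneg_right (pointwise x) (Real.exp_pos (-Ψ x)).le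
    simp only [hU]
    linarith
  have hLi : Integrable (fun x => f x ^ 2 * Real.log (f x ^ 2) * Real.exp (-Ψ x)) := by
    refine (hUi.abs.add hint).mono' ?_ (Eventually.of_forall fun x => ?_)
    · exact (((hfc.pow 2).measurable.mul (Real.measurable_log.comp (hfc.pow 2).measurable)).mul
        (Real.continuous_exp.comp hΨc.neg).measurable).aestronglyMeasurable
    · have h2 := mul_le_mul_of_nonneg_right (neg_one_le_mul_log (sq_nonneg (f x)))
        (Real.exp_pos (-Ψ x)).le
      have h3 := hle x
      have h4 := le_abs_self (U x)
      have h5 := (Real.exp_pos (-Ψ x)).le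
      rw [Real.norm_eq_abs, abs_le]
      simp only [Pi.add_apply]
      constructor <;> linarith [abs_nonneg (U x)]
  refine ⟨hLi, (integral_mono hLi hUi hle).trans ?_⟩
  rw [hUval]
  have hmE : m ≤ 4 * (S₀ * E) := by linarith
  -- V is already O(E), so m ≤ 1 is used here rather than m = O(E), which would give E².
  have hVm : V * m ≤ V := mul_le_of_le_one_right hV0 hm1
  have hVE : V ≤ B * (4 * S₀ + 1 / c * T) * E := by
    rw [hV, mul_assoc B]
    refine mul_le_mul_of_nonneg_left ?_ hB.le
    have : 1 / c * e ≤ 1 / c * (T * E) := mul_le_mul_of_nonneg_left heE (by positivity)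
    linarith
  have hΨm : |Ψ 0| * m ≤ |Ψ 0| * (4 * S₀) * E := by
    rw [mul_assoc]
    exact mul_le_mul_of_nonneg_left (by linarith) (abs_nonneg _)
  have hQE : Q * (m + e) ≤ Q * (4 * S₀ + T) * E := by
    rw [mul_assoc]
    exact mul_le_mul_of_nonneg_left (by linarith) hQ.le
  linarith

/-! ### Transfer to `muExp` and removal of the normalization. -/

section WeightedMeasure

variable {Ψ : ℝ → ℝ}

theorem integrable_muExp_iff (hΨ : Continuous Ψ) {u : ℝ → ℝ} :
    Integrable u (muExp Ψ) ↔ Integrable (fun x => u x * Real.exp (-Ψ x)) := by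
  rw [muExp, integrable_withDensity_iff_integrable_smul' (by fun_prop)
    (Eventually.of_forall fun x => ENNReal.ofReal_lt_top)]
  simp only [ENNReal.toReal_ofReal (Real.exp_pos _).le, smul_eq_mul, mul_comm (Real.exp _)]

theorem integral_muExp (hΨ : Continuous Ψ) (u : ℝ → ℝ) :
    ∫ x, u x ∂(muExp Ψ) = ∫ x, u x * Real.exp (-Ψ x) := by
  rw [muExp, integral_withDensity_eq_integral_toReal_smul (by fun_prop)
    (Eventually.of_forall fun x => ENNReal.ofReal_lt_top)]
  simp only [ENNReal.toReal_ofReal (Real.exp_pos _).le, smul_eq_mul, mul_comm (Real.exp _)]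

end WeightedMeasure

/-- The entropy bound for all locally Lipschitz functions of finite energy. -/
theorem exists_entropy_bound {Ψ G : ℝ → ℝ} (heven : Function.Even Ψ)
    (hconv : ConvexOn ℝ Set.univ Ψ) (hint : Integrable (fun x => Real.exp (-Ψ x)))
    (hone : ∫ x, Real.exp (-Ψ x) = 1) {α M c C L p : ℝ} (hα : 1 < α) (hc : 0 < c) (hC : 0 < C)
    (hp : 1 ≤ p) (hGm : Measurable G) (hGlow : ∀ t, c * t ^ 2 ≤ G t)
    (hG2 : ∀ l s t : ℝ, 1 ≤ l → |s| ≤ l * |t| → G s ≤ C * l ^ (2 * p) * G t)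
    (heuler : ∀ᵐ x : ℝ, α * (Ψ x - M) ≤ x * deriv Ψ x)
    (hyoung : ∀ x t : ℝ, 2 * |x| * |t| ≤ Ψ x + L + C * G t) :
    ∃ A : ℝ, 0 < A ∧ ∀ f : ℝ → ℝ, LocallyLipschitz f →
      Integrable (fun x => G (deriv f x / f x) * f x ^ 2 * Real.exp (-Ψ x)) →
      entropy (muExp Ψ) (fun x => f x ^ 2) ≤
        ENNReal.ofReal (A * ∫ x, G (deriv f x / f x) * f x ^ 2 * Real.exp (-Ψ x)) := by
  obtain ⟨A, hA, hAf⟩ := exists_entropy_bound_of_normalized heven hconv hint hone hα hc hC hp hGm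
    hGlow hG2 heuler hyoung
  obtain ⟨P, -, poincare⟩ := exists_poincare_const heven hconv hint hone
  refine ⟨A, hA, fun f hf hiG => ?_⟩
  have hΨc : Continuous Ψ := hconv.locallyLipschitz.continuous
  have hfc := hf.continuous
  have hi : Integrable (fun x => f x ^ 2 * Real.exp (-Ψ x)) := by
    obtain ⟨h1, -⟩ := poincare f hf (integrable_deriv_sq_of_cost hc hGlow hΨc hiG).1
    refine ((h1.const_mul 2).add (hint.const_mul (2 * f 0 ^ 2))).mono' (by fun_prop)
      (Eventually.of_forall fun x => ?_)
    rw [Real.norm_of_nonneg (by positivity)]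
    have h2 : f x ^ 2 ≤ 2 * (f x - f 0) ^ 2 + 2 * f 0 ^ 2 := by
      nlinarith [sq_nonneg (f x - 2 * f 0)]
    have := mul_le_mul_of_nonneg_right h2 (Real.exp_pos (-Ψ x)).le
    simp only [Pi.add_apply]
    linarith
  set m := ∫ x, f x ^ 2 * Real.exp (-Ψ x) with hm
  have hm0 : 0 ≤ m := integral_nonneg fun x => by positivity
  suffices H : Integrable (fun x => f x ^ 2 * Real.log (f x ^ 2) * Real.exp (-Ψ x)) ∧
      (∫ x, f x ^ 2 * Real.log (f x ^ 2) * Real.exp (-Ψ x)) - m * Real.log m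
        ≤ A * ∫ x, G (deriv f x / f x) * f x ^ 2 * Real.exp (-Ψ x) by
    rw [entropy, if_pos ⟨(integrable_muExp_iff hΨc).2 hi, (integrable_muExp_iff hΨc).2 H.1⟩,
      integral_muExp hΨc, integral_muExp hΨc]
    exact ENNReal.ofReal_le_ofReal H.2
  rcases hm0.eq_or_lt with hmz | hmpos
  · have hz : (fun x => f x ^ 2 * Real.exp (-Ψ x)) =ᵐ[volume] 0 :=
      (integral_eq_zero_iff_of_nonneg (fun x => by positivity) hi).1 hmz.symm
    have hz' : (fun x => f x ^ 2 * Real.log (f x ^ 2) * Real.exp (-Ψ x)) =ᵐ[volume] 0 := by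
      filter_upwards [hz] with x hx
      simp only [Pi.zero_apply, mul_eq_zero, (Real.exp_pos _).ne', or_false] at hx
      simp [hx]
    refine ⟨(integrable_zero ℝ ℝ volume).congr hz'.symm, ?_⟩
    rw [integral_congr_ae hz', ← hmz]
    have hG : ∀ t, 0 ≤ G t := fun t => le_trans (by positivity) (hGlow t)
    have : 0 ≤ ∫ x, G (deriv f x / f x) * f x ^ 2 * Real.exp (-Ψ x) := integral_nonneg fun x =>
      mul_nonneg (mul_nonneg (hG _) (sq_nonneg _)) (Real.exp_pos _).le
    simpa using mul_nonneg hA.le this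
  -- Passing to r|f| leaves f'/f unchanged where f ≠ 0, so entropy and energy both scale by 1/m.
  set r := (Real.sqrt m)⁻¹ with hr
  have hr2 : r ^ 2 = m⁻¹ := by rw [hr, inv_pow, Real.sq_sqrt hm0]
  have hr0 : 0 < r := by positivity
  set h : ℝ → ℝ := fun x => r * |f x| with hh
  have hhl : LocallyLipschitz h := (LocallyLipschitz.const r).mul_real hf.abs_real
  have hh2 : ∀ x, h x ^ 2 = m⁻¹ * f x ^ 2 := fun x => by
    simp only [hh, mul_pow, sq_abs, hr2]
  have hratio : ∀ x, G (deriv h x / h x) * h x ^ 2 = m⁻¹ * (G (deriv f x / f x) * f x ^ 2) := by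
    intro x
    rw [hh2]
    rcases lt_trichotomy (f x) 0 with h0 | h0 | h0
    · have hev : h =ᶠ[nhds x] fun y => -r * f y := by
        filter_upwards [hfc.continuousAt.eventually (gt_mem_nhds h0)] with y hy
        simp [hh, abs_of_neg hy]
      rw [hev.deriv_eq, hev.self_of_nhds, deriv_const_mul_field,
        mul_div_mul_left _ _ (neg_ne_zero.2 hr0.ne')]
      ring
    · simp [h0]
    · have hev : h =ᶠ[nhds x] fun y => r * f y := by
        filter_upwards [hfc.continuousAt.eventually (lt_mem_nhds h0)] with y hy
        simp [hh, abs_of_pos hy]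
      rw [hev.deriv_eq, hev.self_of_nhds, deriv_const_mul_field, mul_div_mul_left _ _ hr0.ne']
      ring
  have e1 : (fun x => h x ^ 2 * Real.exp (-Ψ x))
      = fun x => m⁻¹ * (f x ^ 2 * Real.exp (-Ψ x)) := by
    funext x
    rw [hh2]
    ring
  have e2 : (fun x => G (deriv h x / h x) * h x ^ 2 * Real.exp (-Ψ x))
      = fun x => m⁻¹ * (G (deriv f x / f x) * f x ^ 2 * Real.exp (-Ψ x)) := by
    funext x
    rw [hratio]
    ring
  obtain ⟨k1, k2⟩ := hAf h hhl (fun x => by positivity) (by rw [e1]; exact hi.const_mul _)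
    (by rw [e1, integral_const_mul, ← hm, inv_mul_cancel₀ hmpos.ne'])
    (by rw [e2]; exact hiG.const_mul _)
  have e3 : (fun x => f x ^ 2 * Real.log (f x ^ 2) * Real.exp (-Ψ x))
      = fun x => m * (h x ^ 2 * Real.log (h x ^ 2) * Real.exp (-Ψ x))
        + Real.log m * (f x ^ 2 * Real.exp (-Ψ x)) := by
    funext x
    rw [hh2]
    rcases eq_or_ne (f x) 0 with h0 | h0
    · simp [h0]
    · rw [Real.log_mul (by positivity) (by positivity), Real.log_inv]
      field_simp
      ring
  rw [e2, integral_const_mul] at k2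
  rw [e3]
  refine ⟨(k1.const_mul m).add (hi.const_mul _), ?_⟩
  rw [integral_add (k1.const_mul m) (hi.const_mul _), integral_const_mul, integral_const_mul, ← hm]
  have := mul_le_mul_of_nonneg_left k2 hm0
  have e4 : m * (A * (m⁻¹ * ∫ x, G (deriv f x / f x) * f x ^ 2 * Real.exp (-Ψ x)))
      = A * ∫ x, G (deriv f x / f x) * f x ^ 2 * Real.exp (-Ψ x) := by
    field_simp
  linarith

/-! ### Assembly of the main theorem. -/

theorem mainTheorem10 (Ψ : ℝ → ℝ) (α x₀ : ℝ)
    (heven : Function.Even Ψ)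
    (hconv : ConvexOn ℝ Set.univ Ψ)
    (hprob : IsProbabilityMeasure (muExp Ψ))
    (hα : 1 < α ∧ α ≤ 2)
    (hx₀ : 0 < x₀)
    (hC2 : ContDiffOn ℝ 2 Ψ (Set.Ici x₀))
    (hanti : AntitoneOn (fun x => Ψ x / x ^ 2) (Set.Ici x₀))
    (hmono : MonotoneOn (fun x => Ψ x / x ^ α) (Set.Ici x₀))
    (hlimsup : limsup (fun x : ℝ => ((deriv (deriv Ψ) x / (deriv Ψ x) ^ 2 : ℝ) : EReal)) atTop
      < ((1 - 1 / α : ℝ) : EReal)) :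
    (∀ y : ℝ, BddAbove (Set.range fun x : ℝ => x * y - Ψ x)) ∧
    ∃ C D : ℝ, 0 < C ∧ 0 < D ∧ (∀ t : ℝ, 0 ≤ modifiedCost Ψ C D t) ∧
      ∀ f : ℝ → ℝ, LocallyLipschitz f →
        entropy (muExp Ψ) (fun x => f x ^ 2) ≤
          ∫⁻ x, ENNReal.ofReal (modifiedCost Ψ C D (deriv f x / f x) * f x ^ 2) ∂(muExp Ψ) := by
  obtain ⟨hα1, hα2⟩ := hα
  have hα' : 0 < α - 1 := sub_pos.2 hα1
  have hΨc : Continuous Ψ := hconv.locallyLipschitz.continuous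
  have hint : Integrable (fun x => Real.exp (-Ψ x)) := by
    simpa using (integrable_muExp_iff hΨc).1 (integrable_const (1 : ℝ))
  have hone : ∫ x, Real.exp (-Ψ x) = 1 := by
    simpa using (integral_muExp hΨc (fun _ => (1 : ℝ))).symm
  -- Moving the threshold out makes Ψ X positive, as the lower bound Ψ X (x/X)^α and the nonnegative
  -- constants below require.
  obtain ⟨X, hX, hxX, hΨX⟩ : ∃ X : ℝ, 0 < X ∧ x₀ ≤ X ∧ 0 < Ψ X := by
    obtain ⟨y, hy⟩ := exists_lt_of_integrable_exp_neg hint 0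
    refine ⟨max x₀ |y|, lt_max_of_lt_left hx₀, le_max_left _ _, hy.trans_le ?_⟩
    exact heven.le_of_abs_le_abs hconv ((le_max_right _ _).trans (le_abs_self _))
  have hIci : Set.Ici X ⊆ Set.Ici x₀ := Set.Ici_subset_Ici.2 hxX
  have hmonoX := hmono.mono hIci
  have hantiX := hanti.mono hIci
  have hscale : ∀ ν x : ℝ, 1 ≤ ν → X ≤ x → ν ^ α * Ψ x ≤ Ψ (ν * x) := by
    intro ν x hν hx
    have hx0 : 0 < x := hX.trans_le hx
    have hν0 : 0 < ν := one_pos.trans_le hν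
    have hle : x ≤ ν * x := le_mul_of_one_le_left hx0.le hν
    have := hmonoX (a := x) hx (b := ν * x) (hx.trans hle) hle
    simp only at this
    rw [Real.mul_rpow hν0.le hx0.le, div_le_div_iff₀ (by positivity) (by positivity)] at this
    have hp : 0 < x ^ α := by positivity
    refine le_of_mul_le_mul_right ?_ hp
    linarith
  have hb : ∀ y : ℝ, BddAbove (Set.range fun x : ℝ => x * y - Ψ x) := by
    refine bddAbove_range_of_rpow_le heven hconv hα1 (a := Ψ X / X ^ α) (X := X) (by positivity)
      fun x hx => ?_
    have hx0 : 0 < x := hX.trans_le hx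
    have := hmonoX (a := X) Set.self_mem_Ici (b := x) hx hx
    simp only at this
    rwa [le_div_iff₀ (by positivity)] at this
  have hquad : ∀ x, Ψ x ≤ (1 + Ψ X / X ^ 2 + Ψ X) * (x ^ 2 + 1) := by
    intro x
    have n1 : 0 ≤ Ψ X / X ^ 2 := by positivity
    have n2 : 0 ≤ (1 + Ψ X) * x ^ 2 := by positivity
    have n3 : 0 ≤ Ψ X / X ^ 2 * x ^ 2 := by positivity
    rcases le_or_gt |x| X with hx | hx
    · have : Ψ x ≤ Ψ X := heven.le_of_abs_le_abs hconv (by rwa [abs_of_pos hX])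
      linarith
    · have := hantiX (a := X) Set.self_mem_Ici (b := |x|) hx.le hx.le
      simp only at this
      rw [sq_abs, heven.apply_abs, div_le_iff₀ (by
        rw [← sq_abs]; have := hX.trans hx; positivity)] at this
      linarith
  refine ⟨hb, ?_⟩
  have hK : 1 ≤ 1 + Ψ X / X ^ 2 + Ψ X := by
    have : 0 ≤ Ψ X / X ^ 2 := by positivity
    linarith
  obtain ⟨D, c, C, L, hD, hc, hC, hGlow, hG2, hyoung⟩ :=
    exists_modifiedCost_bounds heven hconv hb hα1 hα2 hX hscale hK hquad
  -- The truncation exponent is half the growth exponent; α ≤ 2 makes it at least 1, so the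
  -- truncation is locally Lipschitz.
  have hp : 1 ≤ α / (α - 1) / 2 := by
    rw [le_div_iff₀ two_pos, le_div_iff₀ hα']
    linarith
  have hq : 2 * (α / (α - 1) / 2) = α / (α - 1) := by ring
  have hGm := measurable_modifiedCost heven hb 1 D
  obtain ⟨A, hA, hent⟩ := exists_entropy_bound heven hconv hint hone hα1 hc hC hp hGm hGlow
    (by rw [hq]; exact hG2) (euler_inequality heven hconv (by linarith) hX hΨX.le hmonoX) hyoung
  have hG : ∀ t, 0 ≤ modifiedCost Ψ 1 D t := fun t => le_trans (by positivity) (hGlow t)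
  refine ⟨A, D, hA, hD, fun t => ?_, fun f hf => ?_⟩
  · rw [modifiedCost_eq_mul]
    exact mul_nonneg hA.le (hG t)
  set F : ℝ → ℝ := fun x => modifiedCost Ψ 1 D (deriv f x / f x) * f x ^ 2 * Real.exp (-Ψ x)
    with hF
  have hF0 : ∀ x, 0 ≤ F x := fun x =>
    mul_nonneg (mul_nonneg (hG _) (sq_nonneg _)) (Real.exp_pos _).le
  have hFm : Measurable F := ((hGm.comp ((measurable_deriv f).div hf.continuous.measurable)).mul
    (hf.continuous.measurable.pow_const 2)).mul (Real.continuous_exp.comp hΨc.neg).measurable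
  have hrhs : ∫⁻ x, ENNReal.ofReal (modifiedCost Ψ A D (deriv f x / f x) * f x ^ 2) ∂(muExp Ψ)
      = ∫⁻ x, ENNReal.ofReal (A * F x) := by
    have hm1 : Measurable fun x => ENNReal.ofReal (Real.exp (-Ψ x)) := by fun_prop
    have hm2 : Measurable fun x =>
        ENNReal.ofReal (modifiedCost Ψ A D (deriv f x / f x) * f x ^ 2) :=
      (((measurable_modifiedCost heven hb A D).comp
        ((measurable_deriv f).div hf.continuous.measurable)).mul
        (hf.continuous.measurable.pow_const 2)).ennreal_ofReal
    rw [muExp, lintegral_withDensity_eq_lintegral_mul₀ hm1.aemeasurable hm2.aemeasurable]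
    refine lintegral_congr fun x => ?_
    simp only [Pi.mul_apply]
    rw [← ENNReal.ofReal_mul (Real.exp_pos _).le, modifiedCost_eq_mul]
    congr 1
    simp only [hF]
    ring
  rw [hrhs]
  by_cases htop : ∫⁻ x, ENNReal.ofReal (A * F x) = ∞
  · rw [htop]
    exact le_top
  have hAF : Integrable (fun x => A * F x) :=
    (lintegral_ofReal_ne_top_iff_integrable (hFm.const_mul A).aestronglyMeasurable
      (Eventually.of_forall fun x => mul_nonneg hA.le (hF0 x))).1 htop
  have hFi : Integrable F := (integrable_const_mul_iff (IsUnit.mk0 A hA.ne') F).1 hAF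
  rw [← ofReal_integral_eq_lintegral_ofReal hAF
    (Eventually.of_forall fun x => mul_nonneg hA.le (hF0 x)), integral_const_mul]
  exact hent f hf hFi
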